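/- Let $B^1,B^2$ be independent standard real Brownian motions on a probability space, let $c_1,c_2>0$, and put $X^j_t=c_jB^j_t$ (so $X^1,X^2$ are independent symmetric stable processes of index $\alpha=2$; $c_1=c_2=1$ is the case of standard Brownian motions). For $\varepsilon>0$ let $$\theta_\varepsilon=\frac{i}{2\pi}\int_0^1\int_0^1\int_{\mathbb R}p\,e^{ip(X^1_t-X^2_s)}\,e^{-\varepsilon p^2/2}\,dp\,ds\,dt .$$ Then, as $\varepsilon\downarrow0$, $\theta_\varepsilon$ converges in $L^r$ for every $r\in(0,\infty)$ to a real random variable $\theta$ (unique up to almost sure equality), the derivative of the intersection local time of $X^1$ and $X^2$ over $[0,1]^2$. Moreover, for every $\beta\in[0,\tfrac23)$ there exists a constant $M>0$ such that $$\mathbb E\big[\exp\{M|\theta|^{\beta}\}\big]<\infty .$$ -/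

import Mathlib

open MeasureTheory ProbabilityTheory Filter Topology
open scoped NNReal ENNReal

/-- The regularised derivative of the intersection local time of two real processes `X`, `Y` on
the time square `[0,1]²`:
`(i / 2π) ∫₀¹ ∫₀¹ ∫_ℝ p exp(i p (X_t - Y_s)) exp(-ε p² / 2) dp ds dt`.
For `ε > 0` the factor `(i / 2π) ∫_ℝ p exp(i p x) exp(-ε p² / 2) dp` is the derivative at `x` of
the Gaussian heat kernel with variance `ε`. -/
noncomputable def diltApprox {Ω : Type*} (X Y : ℝ≥0 → Ω → ℝ) (ε : ℝ) (ω : Ω) : ℂ :=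
  (Complex.I / (2 * (Real.pi : ℂ))) *
    ∫ t in (0 : ℝ)..1, ∫ s in (0 : ℝ)..1, ∫ p : ℝ,
      (p : ℂ) * Complex.exp (Complex.I * p * ((X t.toNNReal ω - Y s.toNNReal ω : ℝ) : ℂ)) *
        Complex.exp (-((ε * p ^ 2 / 2 : ℝ) : ℂ))

/-- The real random variable `θ` is the derivative of intersection local time of `X` and `Y` over
`[0,1]²`: the limit, as `ε ↓ 0`, of the regularised expressions, in `L^r` for every
`r ∈ (0, ∞)`. -/
structure IsDILT {Ω : Type*} [MeasurableSpace Ω] (X Y : ℝ≥0 → Ω → ℝ) (P : Measure Ω)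
    (θ : Ω → ℝ) : Prop where
  aemeasurable : AEMeasurable θ P
  tendsto_Lr : ∀ r : ℝ≥0, 0 < r →
    Tendsto (fun ε : ℝ => eLpNorm (fun ω => diltApprox X Y ε ω - (θ ω : ℂ)) r P)
      (𝓝[>] (0 : ℝ)) (𝓝 0)

/-! By Fubini, θ_ε is the integral over p of a kernel, bounded by |p| uniformly in ε, against the
Fourier transforms of the two occupation measures. Its n-th moment is then an integral over p ∈ ℝⁿ
in which, by independence, the expectation factors into two time integrals of Gaussian
characteristic functions. Convergence and exponential moments both follow from one bound: ∫ ∏|p_k| ·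
`cubeIntegral a p` · `cubeIntegral b p` dp ≤ 4 n! Cⁿ.

To prove it, xy ≤ x² + y² reduces to a single process, and sorting the times reduces to ordered
times at a cost of 2 (n!)². For ordered times with increments r_j the variance is ∑ r_j u_j², where
u_j are the tail sums of p. The factor exp(l(1 − ∑ r_j)) ≥ 1 removes the constraint ∑ r_j ≤ 1 and
leaves e^l ∏ (l + a u_j²)⁻¹ (`orderedIntegral_le`). Since p_k = u_k − u_{k+1}, the weight ∏|p_k|
costs at most two powers of each u_k (`prod_abs_mul_le`), against the four gained by squaring. With
l = n the u-integrals give Cⁿ n⁻ⁿ, and (n!)² n⁻ⁿ ≤ n!.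

The kernel is Hermitian, so θ_ε is real and its even moments are absolute moments. Dominated
convergence in p makes θ_ε Cauchy in every even L^n. The limit inherits the bound 4 n! Cⁿ, hence
exp(M|θ|) is integrable for small M, which covers every power β ≤ 1. -/

/-! ### Product integrals and unimodular changes of variables -/

theorem lintegral_pi_prod_eq_prod {n : ℕ} {μ : Measure ℝ} [SigmaFinite μ]
    {f : Fin n → ℝ → ℝ≥0∞} (hf : ∀ i, Measurable (f i)) :
    ∫⁻ x : Fin n → ℝ, ∏ i, f i (x i) ∂(Measure.pi fun _ => μ) = ∏ i, ∫⁻ x, f i x ∂μ := by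
  induction n with
  | zero => simp
  | succ n ih =>
    rw [← ((measurePreserving_piFinSuccAbove (fun _ : Fin (n + 1) => μ) 0).symm).lintegral_comp_emb
      (MeasurableEquiv.measurableEmbedding _)]
    simp_rw [MeasurableEquiv.piFinSuccAbove_symm_apply, Fin.insertNthEquiv,
      Fin.prod_univ_succ, Fin.insertNth_zero, Equiv.coe_fn_mk, Fin.cons_succ, Fin.cons_zero]
    rw [← ih fun i : Fin n => hf i.succ]
    exact lintegral_prod_mul (hf 0).aemeasurable
      (Finset.measurable_prod Finset.univ fun (i : Fin n) _ =>
        (hf i.succ).comp (measurable_pi_apply i)).aemeasurable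

theorem measurePreserving_mulVec_of_det_eq_one {n : ℕ} {M : Matrix (Fin n) (Fin n) ℝ}
    (hM : M.det = 1) : MeasurePreserving (fun x : Fin n → ℝ => M.mulVec x) := by
  refine ⟨(Matrix.toLin' M).continuous_of_finiteDimensional.measurable, ?_⟩
  have := Real.map_matrix_volume_pi_eq_smul_volume_pi (M := M) (by simp [hM])
  simp only [hM, inv_one, abs_one, ENNReal.ofReal_one, one_smul] at this
  exact this

/-- The partial sums `t_k = ∑_{j ≤ k} r_j`. -/
def headSum {n : ℕ} (r : Fin n → ℝ) (k : Fin n) : ℝ := ∑ j, if j ≤ k then r j else 0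

/-- The tail sums `u_j = ∑_{k ≥ j} p_k`. -/
def tailSum {n : ℕ} (p : Fin n → ℝ) (j : Fin n) : ℝ := ∑ k, if j ≤ k then p k else 0

/-- Partial summation is triangular with unit diagonal. It serves to pass from times to their
increments; `tailSum` is its transpose and acts on the momenta. -/
theorem measurePreserving_headSum (n : ℕ) :
    MeasurePreserving (headSum : (Fin n → ℝ) → Fin n → ℝ) := by
  let M : Matrix (Fin n) (Fin n) ℝ := Matrix.of fun k j => if j ≤ k then 1 else 0
  have hM : M.det = 1 := by
    rw [Matrix.det_of_isLowerTriangular]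
    · simp [M]
    · intro i j hij
      have : i < j := by simpa using hij
      simp [M, this]
  convert measurePreserving_mulVec_of_det_eq_one hM using 1
  ext r k
  simp [headSum, M, Matrix.mulVec, dotProduct]

theorem measurePreserving_tailSum (n : ℕ) :
    MeasurePreserving (tailSum : (Fin n → ℝ) → Fin n → ℝ) := by
  let M : Matrix (Fin n) (Fin n) ℝ := Matrix.of fun k j => if k ≤ j then 1 else 0
  have hM : M.det = 1 := by
    rw [Matrix.det_of_isUpperTriangular]
    · simp [M]
    · intro i j hij
      have : j < i := by simpa using hij
      simp [M, this]
  convert measurePreserving_mulVec_of_det_eq_one hM using 1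
  ext r k
  simp [tailSum, M, Matrix.mulVec, dotProduct]

/-! ### The Brownian quadratic form in increments and tail sums -/

/-- The variance of `∑ p_k B_{t_k}` for a standard Brownian motion `B`. -/
def brownianQuad {n : ℕ} (p t : Fin n → ℝ) : ℝ := ∑ k, ∑ l, p k * p l * min (t k) (t l)

theorem measurable_brownianQuad {n : ℕ} :
    Measurable fun x : (Fin n → ℝ) × (Fin n → ℝ) => brownianQuad x.1 x.2 := by
  unfold brownianQuad
  fun_prop

theorem min_headSum {n : ℕ} {r : Fin n → ℝ} (hr : ∀ j, 0 ≤ r j) (k l : Fin n) :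
    min (headSum r k) (headSum r l) = ∑ j, if j ≤ k ∧ j ≤ l then r j else 0 := by
  have mono : ∀ {k l : Fin n}, k ≤ l → headSum r k ≤ headSum r l := fun {k l} hkl => by
    refine Finset.sum_le_sum fun j _ => ?_
    split_ifs with h1 h2 h2
    · rfl
    · exact absurd (h1.trans hkl) h2
    · exact hr j
    · rfl
  rcases le_total k l with h | h
  · rw [min_eq_left (mono h)]
    exact Finset.sum_congr rfl fun j _ => if_congr ⟨fun h' => ⟨h', h'.trans h⟩, And.left⟩ rfl rfl
  · rw [min_eq_right (mono h)]
    exact Finset.sum_congr rfl fun j _ => if_congr ⟨fun h' => ⟨h'.trans h, h'⟩, And.right⟩ rfl rfl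

/-- Summation by parts: ∑ p_k B_{t_k} is the sum of the independent increments of B, the j-th one
carrying the coefficient u_j = ∑_{k ≥ j} p_k. -/
theorem brownianQuad_headSum {n : ℕ} (p : Fin n → ℝ) {r : Fin n → ℝ} (hr : ∀ j, 0 ≤ r j) :
    brownianQuad p (headSum r) = ∑ j, r j * tailSum p j ^ 2 := by
  let f : Fin n → Fin n → Fin n → ℝ := fun k l j =>
    r j * ((if j ≤ k then p k else 0) * (if j ≤ l then p l else 0))
  calc brownianQuad p (headSum r) = ∑ k, ∑ l, ∑ j, f k l j := by
        simp_rw [brownianQuad, min_headSum hr, Finset.mul_sum]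
        refine Finset.sum_congr rfl fun k _ => Finset.sum_congr rfl fun l _ =>
          Finset.sum_congr rfl fun j _ => ?_
        by_cases h1 : j ≤ k <;> by_cases h2 : j ≤ l <;> simp [f, h1, h2, mul_comm]
    _ = ∑ k, ∑ j, ∑ l, f k l j := Finset.sum_congr rfl fun k _ => Finset.sum_comm
    _ = ∑ j, ∑ k, ∑ l, f k l j := Finset.sum_comm
    _ = ∑ j, r j * tailSum p j ^ 2 := by
        refine Finset.sum_congr rfl fun j _ => ?_
        rw [tailSum, sq, Finset.sum_mul_sum, Finset.mul_sum]
        simp_rw [Finset.mul_sum, f]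

/-- Since p_k = u_k − u_{k+1}, |p_k| ≤ s(1 + |u_k|/s)(1 + |u_{k+1}|/s), and each u_k occurs for at
most two indices. The extra factor on the left strengthens the induction: for the remaining
coordinates it is exactly the 1 + |T|/s produced by p_0. -/
theorem prod_abs_mul_le {n : ℕ} {s : ℝ} (hs : 0 < s) (p : Fin n → ℝ) :
    (∏ k, |p k|) * (1 + |∑ k, p k| / s) ≤ s ^ n * ∏ k, (1 + |tailSum p k| / s) ^ 2 := by
  induction n with
  | zero => simp
  | succ n ih =>
    have h0 : tailSum p 0 = ∑ k, p k := by simp [tailSum]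
    have hsucc : ∀ k : Fin n, tailSum p k.succ = tailSum (fun i => p i.succ) k := fun k => by
      simp [tailSum, Fin.sum_univ_succ]
    rw [Fin.prod_univ_succ, Fin.prod_univ_succ, h0]
    simp_rw [hsucc]
    specialize ih fun i => p i.succ
    set T := ∑ k : Fin n, p k.succ
    set S := ∑ k, p k
    have hST : p 0 = S - T := by simp [S, T, Fin.sum_univ_succ]
    have h1 : |p 0| ≤ s * ((1 + |S| / s) * (1 + |T| / s)) := by
      have : |p 0| ≤ |S| + |T| := hST ▸ abs_sub S T
      refine this.trans ?_
      have e : s * ((1 + |S| / s) * (1 + |T| / s)) = s + |S| + |T| + |S| * |T| / s := by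
        field_simp
        ring
      rw [e]
      have : 0 ≤ |S| * |T| / s := by positivity
      linarith
    calc |p 0| * (∏ i : Fin n, |p i.succ|) * (1 + |S| / s)
        ≤ s * ((1 + |S| / s) * (1 + |T| / s)) * (∏ i : Fin n, |p i.succ|) * (1 + |S| / s) := by
          gcongr
      _ = s * (1 + |S| / s) ^ 2 * ((∏ i : Fin n, |p i.succ|) * (1 + |T| / s)) := by ring
      _ ≤ s * (1 + |S| / s) ^ 2 *
          (s ^ n * ∏ k, (1 + |tailSum (fun i => p i.succ) k| / s) ^ 2) := by gcongr
      _ = s ^ (n + 1) * ((1 + |S| / s) ^ 2 *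
          ∏ k, (1 + |tailSum (fun i => p i.succ) k| / s) ^ 2) := by
        generalize ∏ k, (1 + |tailSum (fun i => p i.succ) k| / s) ^ 2 = Q
        ring

theorem prod_abs_le {n : ℕ} {s : ℝ} (hs : 0 < s) (p : Fin n → ℝ) :
    ∏ k, |p k| ≤ s ^ n * ∏ k, (1 + |tailSum p k| / s) ^ 2 := by
  refine le_trans ?_ (prod_abs_mul_le hs p)
  refine le_mul_of_one_le_right (Finset.prod_nonneg fun _ _ => abs_nonneg _) ?_
  have : 0 ≤ |∑ k, p k| / s := by positivity
  linarith

/-! ### Time integrals over the ordered cube -/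

/-- The ordered points of the cube `(0,1]ⁿ`. -/
def orderedCube (n : ℕ) : Set (Fin n → ℝ) := {t | Monotone t ∧ ∀ i, t i ∈ Set.Ioc (0 : ℝ) 1}

theorem measurableSet_orderedCube (n : ℕ) : MeasurableSet (orderedCube n) := by
  have h : orderedCube n = {t | Monotone t} ∩ Set.pi Set.univ fun _ => Set.Ioc (0 : ℝ) 1 := by
    ext t
    simp [orderedCube]
  rw [h]
  exact isClosed_monotone.measurableSet.inter
    (MeasurableSet.univ_pi fun _ => measurableSet_Ioc)

/-- The integral over the time cube of the characteristic function at `p` of the Brownian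
vector `(√(2 a) B_{t_k})_k`. -/
noncomputable def cubeIntegral (a : ℝ) {n : ℕ} (p : Fin n → ℝ) : ℝ≥0∞ :=
  ∫⁻ t in Set.pi Set.univ fun _ => Set.Ioc (0 : ℝ) 1,
    ENNReal.ofReal (Real.exp (-(a * brownianQuad p t)))

/-- The part of `cubeIntegral` that comes from ordered times. -/
noncomputable def orderedIntegral (a : ℝ) {n : ℕ} (p : Fin n → ℝ) : ℝ≥0∞ :=
  ∫⁻ t in orderedCube n, ENNReal.ofReal (Real.exp (-(a * brownianQuad p t)))

theorem measurable_exp_brownianQuad (a : ℝ) (n : ℕ) :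
    Measurable fun x : (Fin n → ℝ) × (Fin n → ℝ) =>
      ENNReal.ofReal (Real.exp (-(a * brownianQuad x.1 x.2))) := by
  have := measurable_brownianQuad (n := n)
  fun_prop

theorem measurable_exp_brownianQuad_right (a : ℝ) {n : ℕ} (p : Fin n → ℝ) :
    Measurable fun t : Fin n → ℝ => ENNReal.ofReal (Real.exp (-(a * brownianQuad p t))) := by
  unfold brownianQuad
  fun_prop

theorem measurable_cubeIntegral (a : ℝ) (n : ℕ) :
    Measurable (cubeIntegral a : (Fin n → ℝ) → ℝ≥0∞) :=
  (measurable_exp_brownianQuad a n).lintegral_prod_right'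

theorem measurable_orderedIntegral (a : ℝ) (n : ℕ) :
    Measurable (orderedIntegral a : (Fin n → ℝ) → ℝ≥0∞) :=
  (measurable_exp_brownianQuad a n).lintegral_prod_right'

theorem nonneg_and_sum_le_of_headSum_mem {n : ℕ} {r : Fin n → ℝ}
    (h : headSum r ∈ orderedCube n) : (∀ j, 0 ≤ r j) ∧ ∑ j, r j ≤ 1 := by
  cases n with
  | zero => simp
  | succ n =>
    obtain ⟨hm, hI⟩ := h
    constructor
    · intro j
      refine Fin.cases ?_ (fun j => ?_) j
      · have : headSum r 0 = r 0 := by simp [headSum]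
        exact this ▸ (hI 0).1.le
      · have : headSum r j.succ - headSum r j.castSucc = r j.succ := by
          rw [headSum, headSum, ← Finset.sum_sub_distrib,
            Finset.sum_eq_single_of_mem j.succ (Finset.mem_univ _)]
          · simp
          · intro i _ hi
            have : i ≤ j.succ ↔ i ≤ j.castSucc := by
              simp only [Fin.le_def, Fin.ext_iff, Fin.val_succ, Fin.val_castSucc, ne_eq] at hi ⊢
              omega
            simp [this]
        rw [← this]
        exact sub_nonneg.2 (hm (Fin.castSucc_lt_succ).le)
    · have : headSum r (Fin.last n) = ∑ j, r j := by simp [headSum, Fin.le_last]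
      exact this ▸ (hI _).2

theorem lintegral_Ici_exp_neg_mul {b : ℝ} (hb : 0 < b) :
    ∫⁻ x, (Set.Ici (0 : ℝ)).indicator (fun x => ENNReal.ofReal (Real.exp (-b * x))) x =
      ENNReal.ofReal b⁻¹ := by
  rw [lintegral_indicator measurableSet_Ici, setLIntegral_congr Ioi_ae_eq_Ici.symm,
    ← ofReal_integral_eq_lintegral_ofReal (integrableOn_exp_mul_Ioi (by linarith) 0)
      (ae_of_all _ fun _ => (Real.exp_pos _).le), integral_exp_mul_Ioi (by linarith)]
  simp [neg_div_neg_eq]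

/-- In increments the domain lies in {r ≥ 0, ∑ r_j ≤ 1}, where exp(l − l ∑ r_j) ≥ 1. Inserting this
factor and enlarging the domain to the orthant makes the integral a product of one-dimensional
exponential integrals. -/
theorem orderedIntegral_le {a l : ℝ} (ha : 0 < a) (hl : 0 < l) {n : ℕ} (p : Fin n → ℝ) :
    orderedIntegral a p ≤
      ENNReal.ofReal (Real.exp l) * ∏ j, ENNReal.ofReal (l + a * tailSum p j ^ 2)⁻¹ := by
  have hb : ∀ j, 0 < l + a * tailSum p j ^ 2 := fun j => by positivity
  obtain ⟨f, hf_def⟩ : ∃ f : Fin n → ℝ → ℝ≥0∞, ∀ j, f j = (Set.Ici (0 : ℝ)).indicator fun x =>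
    ENNReal.ofReal (Real.exp (-(l + a * tailSum p j ^ 2) * x)) := ⟨_, fun _ => rfl⟩
  have hf : ∀ j, Measurable (f j) := fun j => by
    rw [hf_def]
    exact Measurable.indicator (by fun_prop) measurableSet_Ici
  have key : orderedIntegral a p ≤ ∫⁻ r : Fin n → ℝ,
      ENNReal.ofReal (Real.exp l) * ∏ j, f j (r j) := by
    rw [orderedIntegral, ← lintegral_indicator (measurableSet_orderedCube n),
      ← (measurePreserving_headSum n).lintegral_comp
        ((measurable_exp_brownianQuad_right a p).indicator (measurableSet_orderedCube n))]
    refine lintegral_mono fun r => ?_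
    by_cases hr : headSum r ∈ orderedCube n
    · obtain ⟨h0, h1⟩ := nonneg_and_sum_le_of_headSum_mem hr
      have : ∏ j, f j (r j) =
          ENNReal.ofReal (Real.exp (∑ j, -(l + a * tailSum p j ^ 2) * r j)) := by
        rw [Real.exp_sum, ENNReal.ofReal_prod_of_nonneg fun _ _ => (Real.exp_pos _).le]
        exact Finset.prod_congr rfl fun j _ => by
          rw [hf_def, Set.indicator_of_mem (Set.mem_Ici.2 (h0 j))]
      rw [Set.indicator_of_mem hr, this, ← ENNReal.ofReal_mul (Real.exp_pos _).le, ← Real.exp_add,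
        brownianQuad_headSum p h0]
      refine ENNReal.ofReal_le_ofReal (Real.exp_le_exp.2 ?_)
      have e : ∑ j, -(l + a * tailSum p j ^ 2) * r j =
          -(l * ∑ j, r j) - a * ∑ j, r j * tailSum p j ^ 2 := by
        rw [Finset.mul_sum, Finset.mul_sum, ← Finset.sum_neg_distrib, ← Finset.sum_sub_distrib]
        exact Finset.sum_congr rfl fun j _ => by ring
      rw [e]
      have := mul_le_mul_of_nonneg_left h1 hl.le
      linarith
    · rw [Set.indicator_of_notMem hr]
      exact zero_le
  refine key.trans_eq ?_
  have hprod : Measurable fun r : Fin n → ℝ => ∏ j, f j (r j) := by fun_prop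
  rw [lintegral_const_mul _ hprod]
  congr 1
  rw [show (volume : Measure (Fin n → ℝ)) = Measure.pi fun _ => volume from rfl,
    lintegral_pi_prod_eq_prod hf]
  exact Finset.prod_congr rfl fun j _ => by rw [hf_def, lintegral_Ici_exp_neg_mul (hb j)]

/-! ### Reduction from the cube to ordered times -/

theorem measurePreserving_comp_perm {n : ℕ} (σ : Equiv.Perm (Fin n)) :
    MeasurePreserving fun t : Fin n → ℝ => t ∘ σ := by
  exact volume_preserving_arrowCongr' σ⁻¹ (MeasurableEquiv.refl ℝ) (MeasurePreserving.id _)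

theorem brownianQuad_comp_perm {n : ℕ} (p t : Fin n → ℝ) (σ : Equiv.Perm (Fin n)) :
    brownianQuad (p ∘ σ) (t ∘ σ) = brownianQuad p t := by
  simp only [brownianQuad, Function.comp_apply]
  rw [← Equiv.sum_comp σ fun k => ∑ l, p k * p l * min (t k) (t l)]
  exact Finset.sum_congr rfl fun k _ =>
    Equiv.sum_comp σ fun l => p (σ k) * p l * min (t (σ k)) (t l)

/-- The sorting permutation of t already supplies a term equal to the integrand. Ties are harmless
because only an upper bound is needed. -/
theorem cubeIntegral_le_sum (a : ℝ) {n : ℕ} (p : Fin n → ℝ) :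
    cubeIntegral a p ≤ ∑ σ : Equiv.Perm (Fin n), orderedIntegral a (p ∘ σ) := by
  let H : Equiv.Perm (Fin n) → (Fin n → ℝ) → ℝ≥0∞ := fun σ => (orderedCube n).indicator fun t =>
    ENNReal.ofReal (Real.exp (-(a * brownianQuad (p ∘ σ) t)))
  have hH : ∀ σ, Measurable (H σ) := fun σ =>
    (measurable_exp_brownianQuad_right a (p ∘ σ)).indicator
      (measurableSet_orderedCube n)
  calc cubeIntegral a p
      ≤ ∫⁻ t : Fin n → ℝ, ∑ σ, H σ (t ∘ σ) := by
        rw [cubeIntegral, ← lintegral_indicator (MeasurableSet.univ_pi fun _ => measurableSet_Ioc)]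
        refine lintegral_mono fun t => ?_
        by_cases ht : t ∈ Set.pi Set.univ fun _ => Set.Ioc (0 : ℝ) 1
        swap
        · simp only [Set.indicator_of_notMem ht, zero_le]
        simp only [Set.indicator_of_mem ht]
        have hmem : t ∘ Tuple.sort t ∈ orderedCube n :=
          ⟨Tuple.monotone_sort t, fun i => ht _ (Set.mem_univ _)⟩
        have : H (Tuple.sort t) (t ∘ Tuple.sort t) =
            ENNReal.ofReal (Real.exp (-(a * brownianQuad p t))) := by
          simp only [H, Set.indicator_of_mem hmem, brownianQuad_comp_perm]
        rw [← this]
        exact Finset.single_le_sum (f := fun σ : Equiv.Perm (Fin n) => H σ (t ∘ σ))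
          (fun _ _ => zero_le) (Finset.mem_univ _)
    _ = ∑ σ, ∫⁻ t : Fin n → ℝ, H σ (t ∘ σ) :=
        lintegral_finsetSum _ fun σ _ => (hH σ).comp (measurePreserving_comp_perm σ).measurable
    _ = ∑ σ : Equiv.Perm (Fin n), orderedIntegral a (p ∘ σ) := by
        refine Finset.sum_congr rfl fun σ _ => ?_
        rw [(measurePreserving_comp_perm σ).lintegral_comp (hH σ),
          lintegral_indicator (measurableSet_orderedCube n), orderedIntegral]

theorem ENNReal.mul_le_sq_add_sq (x y : ℝ≥0∞) : x * y ≤ x ^ 2 + y ^ 2 := by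
  rcases le_total x y with h | h
  · exact (mul_le_mul_left h y).trans (by rw [sq y]; exact le_add_self)
  · exact (mul_le_mul_right h x).trans (by rw [sq x]; exact le_self_add)

/-- The square of a sum of n! terms is at most 2 n! times the sum of squares. Each square has the
same integral, as ∏|p_k| and the measure are permutation invariant, which gives the second n!. -/
theorem lintegral_prod_mul_cubeIntegral_sq_le (a : ℝ) (n : ℕ) :
    ∫⁻ p : Fin n → ℝ, (∏ k, ‖p k‖ₑ) * cubeIntegral a p ^ 2 ≤
      2 * (n.factorial : ℝ≥0∞) ^ 2 *
        ∫⁻ p : Fin n → ℝ, (∏ k, ‖p k‖ₑ) * orderedIntegral a p ^ 2 := by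
  let K : (Fin n → ℝ) → ℝ≥0∞ := fun p => (∏ k, ‖p k‖ₑ) * orderedIntegral a p ^ 2
  have hK : Measurable K := by
    have := measurable_orderedIntegral a n
    fun_prop
  have hcard : (Fintype.card (Equiv.Perm (Fin n)) : ℝ≥0∞) = n.factorial := by
    simp [Fintype.card_perm]
  have hpt : ∀ p : Fin n → ℝ, (∏ k, ‖p k‖ₑ) * cubeIntegral a p ^ 2 ≤
      2 * (n.factorial : ℝ≥0∞) * ∑ σ : Equiv.Perm (Fin n), K (p ∘ σ) := by
    intro p
    have h1 : cubeIntegral a p ^ 2 ≤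
        2 * (n.factorial : ℝ≥0∞) * ∑ σ : Equiv.Perm (Fin n), orderedIntegral a (p ∘ σ) ^ 2 := by
      calc cubeIntegral a p ^ 2
          ≤ (∑ σ : Equiv.Perm (Fin n), orderedIntegral a (p ∘ σ)) ^ 2 := by
            gcongr; exact cubeIntegral_le_sum a p
        _ ≤ ∑ σ : Equiv.Perm (Fin n), ∑ τ : Equiv.Perm (Fin n),
            (orderedIntegral a (p ∘ σ) ^ 2 + orderedIntegral a (p ∘ τ) ^ 2) := by
            rw [sq, Finset.sum_mul_sum]
            exact Finset.sum_le_sum fun _ _ => Finset.sum_le_sum fun _ _ =>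
              ENNReal.mul_le_sq_add_sq _ _
        _ = _ := by
            simp_rw [Finset.sum_add_distrib, Finset.sum_const, Finset.card_univ, nsmul_eq_mul,
              ← Finset.mul_sum, hcard]
            ring
    calc _ ≤ (∏ k, ‖p k‖ₑ) * _ := mul_le_mul_right h1 _
      _ = _ := by
        simp_rw [Finset.mul_sum, K]
        refine Finset.sum_congr rfl fun σ _ => ?_
        have : ∏ k, ‖(p ∘ σ) k‖ₑ = ∏ k, ‖p k‖ₑ := Equiv.prod_comp σ fun k => ‖p k‖ₑ
        rw [this]
        ring
  calc _ ≤ ∫⁻ p : Fin n → ℝ, 2 * (n.factorial : ℝ≥0∞) * ∑ σ : Equiv.Perm (Fin n), K (p ∘ σ) :=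
        lintegral_mono hpt
    _ = 2 * (n.factorial : ℝ≥0∞) * ∑ σ : Equiv.Perm (Fin n), ∫⁻ p, K p := by
        have hKσ : ∀ σ : Equiv.Perm (Fin n), Measurable fun p : Fin n → ℝ => K (p ∘ σ) := fun σ =>
          hK.comp (measurePreserving_comp_perm σ).measurable
        rw [lintegral_const_mul _ (Finset.measurable_sum _ fun σ _ => hKσ σ),
          lintegral_finsetSum _ fun σ _ => hKσ σ]
        congr 1
        exact Finset.sum_congr rfl fun σ _ =>
          (measurePreserving_comp_perm σ).lintegral_comp hK
    _ = _ := by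
        rw [Finset.sum_const, Finset.card_univ, nsmul_eq_mul, hcard]
        ring

/-! ### Growth of the momentum integrals -/

theorem lintegral_inv_one_add_div_sq {s : ℝ} (hs : 0 < s) :
    ∫⁻ u : ℝ, ENNReal.ofReal (1 + (u / s) ^ 2)⁻¹ = ENNReal.ofReal (s * Real.pi) := by
  rw [← ofReal_integral_eq_lintegral_ofReal (integrable_inv_one_add_sq.comp_div hs.ne')
    (ae_of_all _ fun _ => by positivity),
    Measure.integral_comp_div (fun x : ℝ => (1 + x ^ 2)⁻¹), integral_univ_inv_one_add_sq,
    abs_of_pos hs, smul_eq_mul]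

/-- Two of the four powers of decay pay for the momentum weight, and the remaining two are
integrable. The constant `min a 1` compares s² + a u² with s² + u². -/
theorem weight_le {a s : ℝ} (ha : 0 < a) (hs : 0 < s) (u : ℝ) :
    (1 + |u| / s) ^ 2 * ((s ^ 2 + a * u ^ 2)⁻¹) ^ 2 ≤
      2 / (s ^ 4 * min a 1 ^ 2) * (1 + (u / s) ^ 2)⁻¹ := by
  have hm : 0 < min a 1 := lt_min ha one_pos
  set v := |u| / s with hv
  have hv2 : (u / s) ^ 2 = v ^ 2 := by rw [hv, div_pow, div_pow, sq_abs]
  have hu : u ^ 2 = s ^ 2 * v ^ 2 := by rw [← hv2]; field_simp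
  rw [hv2, hu]
  have h1 : s ^ 2 * min a 1 * (1 + v ^ 2) ≤ s ^ 2 + a * (s ^ 2 * v ^ 2) := by
    have h2 : min a 1 * v ^ 2 ≤ a * v ^ 2 := by gcongr; exact min_le_left _ _
    have h3 : min a 1 ≤ 1 := min_le_right _ _
    have : min a 1 * (1 + v ^ 2) ≤ 1 + a * v ^ 2 := by linarith
    calc _ = s ^ 2 * (min a 1 * (1 + v ^ 2)) := by ring
      _ ≤ s ^ 2 * (1 + a * v ^ 2) := by gcongr
      _ = _ := by ring
  calc (1 + v) ^ 2 * ((s ^ 2 + a * (s ^ 2 * v ^ 2))⁻¹) ^ 2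
      ≤ (2 * (1 + v ^ 2)) * ((s ^ 2 * min a 1 * (1 + v ^ 2))⁻¹) ^ 2 := by
        gcongr
        nlinarith [sq_nonneg (1 - v)]
    _ = _ := by field_simp

/-- The growth rate of the momentum integrals. -/
noncomputable def growthConst (a : ℝ) : ℝ := Real.exp 2 * (2 * Real.pi / min a 1 ^ 2)

theorem growthConst_pos {a : ℝ} (ha : 0 < a) : 0 < growthConst a := by
  have hm : 0 < min a 1 := lt_min ha one_pos
  unfold growthConst
  positivity

theorem lintegral_prod_mul_orderedIntegral_sq_le {a : ℝ} (ha : 0 < a) {n : ℕ} (hn : n ≠ 0) :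
    ∫⁻ p : Fin n → ℝ, (∏ k, ‖p k‖ₑ) * orderedIntegral a p ^ 2 ≤
      ENNReal.ofReal (growthConst a ^ n / n ^ n) := by
  have hn' : (0 : ℝ) < n := by positivity
  have hm : 0 < min a 1 := lt_min ha one_pos
  -- The free parameter is l = s² = n. Per coordinate, s from the weight, s⁻⁴ from `weight_le` and s
  -- from the integral in u combine to s⁻² = 1/n, while e^l squared gives only e^(2n).
  set s := Real.sqrt n with hs_def
  have hs : 0 < s := Real.sqrt_pos.2 hn'
  have hs2 : s ^ 2 = n := Real.sq_sqrt hn'.le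
  let w : ℝ → ℝ≥0∞ := fun u => ENNReal.ofReal (2 / (s ^ 4 * min a 1 ^ 2) * (1 + (u / s) ^ 2)⁻¹)
  have hw : Measurable w := by fun_prop
  let W : (Fin n → ℝ) → ℝ≥0∞ := fun u =>
    ENNReal.ofReal (s ^ n * Real.exp (s ^ 2) ^ 2) * ∏ k, w (u k)
  have hWm : Measurable fun u : Fin n → ℝ => ∏ k, w (u k) := by fun_prop
  have hpt : ∀ p : Fin n → ℝ, (∏ k, ‖p k‖ₑ) * orderedIntegral a p ^ 2 ≤ W (tailSum p) := by
    intro p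
    have h1 : ∏ k, ‖p k‖ₑ = ENNReal.ofReal (∏ k, |p k|) := by
      rw [ENNReal.ofReal_prod_of_nonneg fun _ _ => abs_nonneg _]
      exact Finset.prod_congr rfl fun k _ => by rw [← ofReal_norm, Real.norm_eq_abs]
    have h2 := orderedIntegral_le ha (pow_pos hs 2) p
    have h3 : ∀ k, 0 ≤ (s ^ 2 + a * tailSum p k ^ 2)⁻¹ := fun k => by positivity
    rw [← ENNReal.ofReal_prod_of_nonneg fun k _ => h3 k,
      ← ENNReal.ofReal_mul (Real.exp_pos _).le] at h2
    have h4 : 0 ≤ ∏ k, |p k| := Finset.prod_nonneg fun _ _ => abs_nonneg _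
    have h5 : 0 ≤ ∏ k, (s ^ 2 + a * tailSum p k ^ 2)⁻¹ := Finset.prod_nonneg fun k _ => h3 k
    calc _ ≤ ENNReal.ofReal (∏ k, |p k|) *
          ENNReal.ofReal (Real.exp (s ^ 2) * ∏ k, (s ^ 2 + a * tailSum p k ^ 2)⁻¹) ^ 2 := by
          rw [h1]; gcongr
      _ = ENNReal.ofReal ((∏ k, |p k|) *
          (Real.exp (s ^ 2) * ∏ k, (s ^ 2 + a * tailSum p k ^ 2)⁻¹) ^ 2) := by
          rw [← ENNReal.ofReal_pow (by positivity), ← ENNReal.ofReal_mul h4]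
      _ ≤ ENNReal.ofReal (s ^ n * Real.exp (s ^ 2) ^ 2 *
          ∏ k, (2 / (s ^ 4 * min a 1 ^ 2) * (1 + (tailSum p k / s) ^ 2)⁻¹)) := by
          refine ENNReal.ofReal_le_ofReal ?_
          calc _ ≤ (s ^ n * ∏ k, (1 + |tailSum p k| / s) ^ 2) *
                (Real.exp (s ^ 2) * ∏ k, (s ^ 2 + a * tailSum p k ^ 2)⁻¹) ^ 2 := by
                gcongr; exact prod_abs_le hs p
            _ = s ^ n * Real.exp (s ^ 2) ^ 2 * ∏ k, ((1 + |tailSum p k| / s) ^ 2 *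
                ((s ^ 2 + a * tailSum p k ^ 2)⁻¹) ^ 2) := by
                rw [Finset.prod_mul_distrib, Finset.prod_pow, Finset.prod_pow]
                ring
            _ ≤ _ := by
                refine mul_le_mul_of_nonneg_left (Finset.prod_le_prod (fun k _ => ?_)
                  fun k _ => weight_le ha hs _) (by positivity)
                positivity
      _ = W (tailSum p) := by
          rw [ENNReal.ofReal_mul (by positivity), ENNReal.ofReal_prod_of_nonneg]
          intro k _
          positivity
  have hint : ∫⁻ u, w u = ENNReal.ofReal (2 / (s ^ 4 * min a 1 ^ 2) * (s * Real.pi)) := by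
    have : ∀ u, w u = ENNReal.ofReal (2 / (s ^ 4 * min a 1 ^ 2)) *
        ENNReal.ofReal (1 + (u / s) ^ 2)⁻¹ := fun u => ENNReal.ofReal_mul (by positivity)
    simp_rw [this]
    rw [lintegral_const_mul _ (by fun_prop), lintegral_inv_one_add_div_sq hs,
      ← ENNReal.ofReal_mul (by positivity)]
  calc _ ≤ ∫⁻ p : Fin n → ℝ, W (tailSum p) := lintegral_mono hpt
    _ = ∫⁻ u, W u := (measurePreserving_tailSum n).lintegral_comp (hWm.const_mul _)
    _ = ENNReal.ofReal (s ^ n * Real.exp (s ^ 2) ^ 2) *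
        ENNReal.ofReal (2 / (s ^ 4 * min a 1 ^ 2) * (s * Real.pi)) ^ n := by
        rw [lintegral_const_mul _ hWm,
          show (volume : Measure (Fin n → ℝ)) = Measure.pi fun _ => volume from rfl,
          lintegral_pi_prod_eq_prod (f := fun _ => w) fun _ => hw]
        simp [hint]
    _ = _ := by
        rw [← ENNReal.ofReal_pow (by positivity), ← ENNReal.ofReal_mul (by positivity)]
        congr 1
        have e1 : Real.exp (s ^ 2) ^ 2 = Real.exp 2 ^ n := by
          rw [hs2, ← Real.exp_nat_mul, ← Real.exp_nat_mul]
          congr 1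
          push_cast
          ring
        have e2 : s * (2 / (s ^ 4 * min a 1 ^ 2) * (s * Real.pi)) =
            2 * Real.pi / min a 1 ^ 2 / n := by
          rw [← hs2]
          field_simp
        calc _ = Real.exp 2 ^ n * (s * (2 / (s ^ 4 * min a 1 ^ 2) * (s * Real.pi))) ^ n := by
              rw [e1]; ring
          _ = _ := by
              rw [e2, growthConst, ← div_pow, ← mul_pow]
              congr 1
              ring


/-- The `n`-th momentum integral of two independent Brownian motions grows like `Cⁿ n!`. -/
theorem lintegral_prod_mul_cubeIntegral_sq_le_factorial {a : ℝ} (ha : 0 < a) {n : ℕ}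
    (hn : n ≠ 0) :
    ∫⁻ p : Fin n → ℝ, (∏ k, ‖p k‖ₑ) * cubeIntegral a p ^ 2 ≤
      ENNReal.ofReal (2 * n.factorial * growthConst a ^ n) := by
  have hC := growthConst_pos ha
  refine (lintegral_prod_mul_cubeIntegral_sq_le a n).trans ?_
  calc _ ≤ 2 * (n.factorial : ℝ≥0∞) ^ 2 * ENNReal.ofReal (growthConst a ^ n / n ^ n) := by
        gcongr; exact lintegral_prod_mul_orderedIntegral_sq_le ha hn
    _ = ENNReal.ofReal (2 * (n.factorial : ℝ) ^ 2 * (growthConst a ^ n / n ^ n)) := by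
        rw [ENNReal.ofReal_mul (by positivity), ENNReal.ofReal_mul (by positivity),
          ENNReal.ofReal_pow (by positivity), ENNReal.ofReal_natCast, ENNReal.ofReal_ofNat]
    _ ≤ _ := by
        refine ENNReal.ofReal_le_ofReal ?_
        -- One of the two factorials is absorbed by n⁻ⁿ; this leaves the n! needed for an
        -- exponential moment.
        have hf : (n.factorial : ℝ) ≤ (n : ℝ) ^ n := by exact_mod_cast Nat.factorial_le_pow n
        have hn' : (0 : ℝ) < n := by positivity
        calc _ = 2 * n.factorial * growthConst a ^ n * (n.factorial / (n : ℝ) ^ n) := by ring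
          _ ≤ 2 * n.factorial * growthConst a ^ n * 1 := by
              gcongr
              exact (div_le_one (by positivity)).2 hf
          _ = _ := mul_one _

theorem exists_lintegral_prod_mul_cubeIntegral_le {a b : ℝ} (ha : 0 < a) (hb : 0 < b) :
    ∃ C : ℝ, 0 < C ∧ ∀ n : ℕ, n ≠ 0 →
      ∫⁻ p : Fin n → ℝ, (∏ k, ‖p k‖ₑ) * (cubeIntegral a p * cubeIntegral b p) ≤
        ENNReal.ofReal (4 * n.factorial * C ^ n) := by
  have hA := growthConst_pos ha
  have hB := growthConst_pos hb
  refine ⟨max (growthConst a) (growthConst b), lt_max_of_lt_left hA, fun n hn => ?_⟩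
  have hm : ∀ c, Measurable fun p : Fin n → ℝ => (∏ k, ‖p k‖ₑ) * cubeIntegral c p ^ 2 := fun c => by
    have := measurable_cubeIntegral c n
    fun_prop
  calc _ ≤ ∫⁻ p : Fin n → ℝ, ((∏ k, ‖p k‖ₑ) * cubeIntegral a p ^ 2 +
        (∏ k, ‖p k‖ₑ) * cubeIntegral b p ^ 2) := by
        refine lintegral_mono fun p => ?_
        simp only [← mul_add]
        gcongr
        exact ENNReal.mul_le_sq_add_sq _ _
    _ ≤ ENNReal.ofReal (2 * n.factorial * growthConst a ^ n) +
        ENNReal.ofReal (2 * n.factorial * growthConst b ^ n) := by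
        rw [lintegral_add_left (hm a)]
        gcongr
        · exact lintegral_prod_mul_cubeIntegral_sq_le_factorial ha hn
        · exact lintegral_prod_mul_cubeIntegral_sq_le_factorial hb hn
    _ ≤ _ := by
        rw [← ENNReal.ofReal_add (by positivity) (by positivity)]
        refine ENNReal.ofReal_le_ofReal ?_
        have h1 : growthConst a ^ n ≤ max (growthConst a) (growthConst b) ^ n := by
          gcongr; exact le_max_left _ _
        have h2 : growthConst b ^ n ≤ max (growthConst a) (growthConst b) ^ n := by
          gcongr; exact le_max_right _ _
        have h3 : (0 : ℝ) ≤ 2 * n.factorial := by positivity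
        nlinarith [mul_le_mul_of_nonneg_left h1 h3, mul_le_mul_of_nonneg_left h2 h3]

/-! ### Moments of occupation functionals -/

section Occupation

variable {Ω : Type*} {φ ψ : ℝ → ℂ}

/-- The Fourier integral `∫₀¹ exp(i p x_t) dt` of the occupation measure of a path. -/
noncomputable def occupationFourier (x : ℝ → Ω → ℝ) (p : ℝ) (ω : Ω) : ℂ :=
  ∫ t in Set.Ioc (0 : ℝ) 1, Complex.exp (Complex.I * ((p * x t ω : ℝ) : ℂ))

/-- The occupation functional `∫ φ(p) ∫₀¹ ∫₀¹ exp(i p (x_t - y_s)) ds dt dp`. -/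
noncomputable def intersectionFunctional (x y : ℝ → Ω → ℝ) (φ : ℝ → ℂ) (ω : Ω) : ℂ :=
  ∫ p : ℝ, φ p * (occupationFourier x p ω * occupationFourier y (-p) ω)

theorem norm_occupationFourier_le (x : ℝ → Ω → ℝ) (p : ℝ) (ω : Ω) :
    ‖occupationFourier x p ω‖ ≤ 1 := by
  refine (norm_integral_le_of_norm_le_const (C := 1) (ae_of_all _ fun t => ?_)).trans (by simp)
  rw [mul_comm, Complex.norm_exp_ofReal_mul_I]

theorem conj_occupationFourier (x : ℝ → Ω → ℝ) (p : ℝ) (ω : Ω) :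
    (starRingEnd ℂ) (occupationFourier x p ω) = occupationFourier x (-p) ω := by
  rw [occupationFourier, occupationFourier, ← integral_conj]
  refine integral_congr_ae (ae_of_all _ fun t => ?_)
  simp only [← Complex.exp_conj, map_mul, Complex.conj_I, Complex.conj_ofReal]
  push_cast
  ring_nf

theorem prod_occupationFourier (x : ℝ → Ω → ℝ) {n : ℕ} (p : Fin n → ℝ) (ω : Ω) :
    ∏ k, occupationFourier x (p k) ω =
      ∫ t, ∏ k, Complex.exp (Complex.I * ((p k * x (t k) ω : ℝ) : ℂ))
        ∂(Measure.pi fun _ : Fin n => (volume : Measure ℝ).restrict (Set.Ioc (0 : ℝ) 1)) :=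
  (integral_fintype_prod_eq_prod (μ := fun _ => (volume : Measure ℝ).restrict (Set.Ioc (0 : ℝ) 1))
    fun k t => Complex.exp (Complex.I * ((p k * x t ω : ℝ) : ℂ))).symm

theorem norm_intersectionFunctional_le (x y : ℝ → Ω → ℝ) (hφ : Integrable φ) (ω : Ω) :
    ‖intersectionFunctional x y φ ω‖ ≤ ∫ p, ‖φ p‖ := by
  refine norm_integral_le_of_norm_le hφ.norm (ae_of_all _ fun p => ?_)
  rw [norm_mul, norm_mul]
  exact mul_le_of_le_one_right (norm_nonneg _) (mul_le_one₀ (norm_occupationFourier_le x p ω)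
    (norm_nonneg _) (norm_occupationFourier_le y (-p) ω))

/-- Conjugation replaces p by −p in every factor, and Lebesgue measure is symmetric; so a Hermitian
kernel gives a real functional. -/
theorem conj_intersectionFunctional (x y : ℝ → Ω → ℝ)
    (hφ : ∀ p, (starRingEnd ℂ) (φ p) = φ (-p)) (ω : Ω) :
    (starRingEnd ℂ) (intersectionFunctional x y φ ω) = intersectionFunctional x y φ ω := by
  rw [intersectionFunctional, ← integral_conj]
  simp only [map_mul, hφ, conj_occupationFourier]
  exact integral_neg_eq_self
    (fun p => φ p * (occupationFourier x p ω * occupationFourier y (-p) ω)) volume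

variable [MeasurableSpace Ω]

/-- The exponent is a centred Gaussian variable, and the integral is its characteristic function at
1. -/
theorem integral_cexp_sum_brownian {P : Measure Ω} {B : ℝ≥0 → Ω → ℝ}
    (hB : IsPreBrownianReal B P) (c : ℝ) {n : ℕ} (p : Fin n → ℝ)
    {t : Fin n → ℝ} (ht : ∀ k, 0 ≤ t k) :
    ∫ ω, Complex.exp (Complex.I * ((∑ k, p k * (c * B (t k).toNNReal ω) : ℝ) : ℂ)) ∂P =
      (Real.exp (-(c ^ 2 / 2 * brownianQuad p t)) : ℂ) := by
  have := hB.isGaussianProcess.isProbabilityMeasure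
  set S : Ω → ℝ := fun ω => ∑ k, p k * (c * B (t k).toNNReal ω) with hS
  have hmem : ∀ k, MemLp (fun ω => p k * (c * B (t k).toNNReal ω)) 2 P := fun k =>
    ((hB.isGaussianProcess.hasGaussianLaw_eval _).memLp_two.const_mul c).const_mul (p k)
  have hG : HasGaussianLaw S P := by
    have h1 := (hB.isGaussianProcess.comp_right fun k : Fin n => (t k).toNNReal).smul
      fun k => p k * c
    have h2 := h1.hasGaussianLaw_fun_sum (I := Finset.univ)
    simpa only [Function.comp_apply, smul_eq_mul, mul_assoc] using h2
  have hmean : P[S] = 0 := by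
    rw [hS, integral_finsetSum _ fun k _ => (hmem k).integrable (by norm_num)]
    refine Finset.sum_eq_zero fun k _ => ?_
    rw [integral_const_mul, integral_const_mul, hB.integral_eval, mul_zero, mul_zero]
  have hvar : Var[S; P] = c ^ 2 * brownianQuad p t := by
    rw [hS, variance_fun_sum hmem, brownianQuad, Finset.mul_sum]
    refine Finset.sum_congr rfl fun k _ => ?_
    rw [Finset.mul_sum]
    refine Finset.sum_congr rfl fun l _ => ?_
    rw [covariance_const_mul_left, covariance_const_mul_right, covariance_const_mul_left,
      covariance_const_mul_right, hB.covariance_fun_eval, NNReal.coe_min,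
      Real.coe_toNNReal _ (ht k), Real.coe_toNNReal _ (ht l)]
    ring
  have hchar : charFun (P.map S) 1 = (Real.exp (-(c ^ 2 / 2 * brownianQuad p t)) : ℂ) := by
    rw [hG.map_eq_gaussianReal, charFun_gaussianReal, hmean,
      Real.coe_toNNReal _ (variance_nonneg _ _), hvar]
    push_cast
    congr 1
    ring
  rw [← hchar, charFun_apply_real, integral_map hG.aemeasurable (by fun_prop)]
  refine integral_congr_ae (ae_of_all _ fun ω => ?_)
  simp only [S, Complex.ofReal_one, one_mul, mul_comm Complex.I]

theorem stronglyMeasurable_occupationFourier {x : ℝ → Ω → ℝ}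
    (hx : Measurable (Function.uncurry x)) :
    StronglyMeasurable fun z : ℝ × Ω => occupationFourier x z.1 z.2 := by
  have hm : Measurable fun z : (ℝ × Ω) × ℝ =>
      Complex.exp (Complex.I * ((z.1.1 * x z.2 z.1.2 : ℝ) : ℂ)) := by
    have : Measurable fun z : (ℝ × Ω) × ℝ => x z.2 z.1.2 :=
      hx.comp (measurable_snd.prodMk (measurable_snd.comp measurable_fst))
    fun_prop
  exact hm.stronglyMeasurable.integral_prod_right

theorem measurable_occupationFourier_left {x : ℝ → Ω → ℝ}
    (hx : Measurable (Function.uncurry x)) (ω : Ω) : Measurable fun p => occupationFourier x p ω :=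
  (stronglyMeasurable_occupationFourier hx).measurable.comp measurable_prodMk_right

section Functional

variable {P : Measure Ω} [IsProbabilityMeasure P] {x y : ℝ → Ω → ℝ}

theorem integrable_intersectionFunctional_integrand (hx : Measurable (Function.uncurry x))
    (hy : Measurable (Function.uncurry y)) (hφ : Integrable φ) (ω : Ω) :
    Integrable fun p => φ p * (occupationFourier x p ω * occupationFourier y (-p) ω) := by
  refine hφ.mul_bdd (c := 1) ?_ (ae_of_all _ fun p => ?_)
  · exact ((measurable_occupationFourier_left hx ω).mul
      ((measurable_occupationFourier_left hy ω).comp measurable_neg)).aestronglyMeasurable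
  · rw [norm_mul]
    exact mul_le_one₀ (norm_occupationFourier_le x p ω) (norm_nonneg _)
      (norm_occupationFourier_le y (-p) ω)

theorem intersectionFunctional_sub (hx : Measurable (Function.uncurry x))
    (hy : Measurable (Function.uncurry y)) (hφ : Integrable φ) (hψ : Integrable ψ) (ω : Ω) :
    intersectionFunctional x y (φ - ψ) ω =
      intersectionFunctional x y φ ω - intersectionFunctional x y ψ ω := by
  rw [intersectionFunctional, intersectionFunctional, intersectionFunctional,
    ← integral_sub (integrable_intersectionFunctional_integrand hx hy hφ ω)
      (integrable_intersectionFunctional_integrand hx hy hψ ω)]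
  simp [sub_mul]

theorem stronglyMeasurable_intersectionFunctional (hx : Measurable (Function.uncurry x))
    (hy : Measurable (Function.uncurry y)) (hφ : Measurable φ) :
    StronglyMeasurable (intersectionFunctional x y φ) := by
  have h1 := (stronglyMeasurable_occupationFourier hx).measurable
  have h2 := (stronglyMeasurable_occupationFourier hy).measurable
  have : Measurable fun z : Ω × ℝ =>
      φ z.2 * (occupationFourier x z.2 z.1 * occupationFourier y (-z.2) z.1) :=
    (hφ.comp measurable_snd).mul ((h1.comp (measurable_snd.prodMk measurable_fst)).mul
      (h2.comp (measurable_snd.neg.prodMk measurable_fst)))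
  exact this.stronglyMeasurable.integral_prod_right

/-- The processes `x` and `y` have the finite-dimensional characteristic functions of two
independent centred Brownian motions with variances `2 a t` and `2 b t`. -/
def HasBrownianCharFun (P : Measure Ω) (x y : ℝ → Ω → ℝ) (a b : ℝ) : Prop :=
  ∀ (n : ℕ) (p t s : Fin n → ℝ), (∀ k, 0 ≤ t k) → (∀ k, 0 ≤ s k) →
    ∫ ω, (∏ k, Complex.exp (Complex.I * ((p k * x (t k) ω : ℝ) : ℂ))) *
        ∏ k, Complex.exp (Complex.I * ((-p k * y (s k) ω : ℝ) : ℂ)) ∂P =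
      (Real.exp (-(a * brownianQuad p t)) : ℂ) * (Real.exp (-(b * brownianQuad p s)) : ℂ)

theorem pi_restrict_Ioc (n : ℕ) :
    (Measure.pi fun _ : Fin n => (volume : Measure ℝ).restrict (Set.Ioc (0 : ℝ) 1)) =
      volume.restrict (Set.pi Set.univ fun _ => Set.Ioc (0 : ℝ) 1) :=
  (Measure.restrict_pi_pi (fun _ : Fin n => (volume : Measure ℝ)) fun _ => Set.Ioc (0 : ℝ) 1).symm

theorem enorm_integral_cube_le (a : ℝ) {n : ℕ} (p : Fin n → ℝ) :
    ‖∫ t, (Real.exp (-(a * brownianQuad p t)) : ℂ)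
      ∂(Measure.pi fun _ : Fin n => (volume : Measure ℝ).restrict (Set.Ioc (0 : ℝ) 1))‖ₑ ≤
      cubeIntegral a p := by
  refine (enorm_integral_le_lintegral_enorm _).trans_eq ?_
  rw [pi_restrict_Ioc, cubeIntegral]
  refine lintegral_congr fun t => ?_
  rw [← ofReal_norm, Complex.norm_real, Real.norm_of_nonneg (Real.exp_pos _).le]

theorem ae_pi_restrict_Ioc_nonneg (n : ℕ) :
    ∀ᵐ t ∂(Measure.pi fun _ : Fin n => (volume : Measure ℝ).restrict (Set.Ioc (0 : ℝ) 1)),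
      ∀ k, 0 ≤ t k := by
  rw [pi_restrict_Ioc]
  filter_upwards [ae_restrict_mem (MeasurableSet.univ_pi fun _ => measurableSet_Ioc)] with t ht k
  exact (ht k (Set.mem_univ k)).1.le

/-- The product is an integral over two time cubes of exponentials of modulus one. Fubini brings the
expectation inside, where it splits into a function of t times a function of s. -/
theorem enorm_integral_prod_occupationFourier_le (hx : Measurable (Function.uncurry x))
    (hy : Measurable (Function.uncurry y)) {a b : ℝ} (hchar : HasBrownianCharFun P x y a b)
    {n : ℕ} (p : Fin n → ℝ) :
    ‖∫ ω, ∏ k, (occupationFourier x (p k) ω * occupationFourier y (-p k) ω) ∂P‖ₑ ≤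
      cubeIntegral a p * cubeIntegral b p := by
  set μ := Measure.pi fun _ : Fin n => (volume : Measure ℝ).restrict (Set.Ioc (0 : ℝ) 1) with hμ
  let E : (ℝ → Ω → ℝ) → (Fin n → ℝ) → (Fin n → ℝ) → Ω → ℂ := fun x p t ω =>
    ∏ k, Complex.exp (Complex.I * ((p k * x (t k) ω : ℝ) : ℂ))
  have hEn : ∀ x p t ω, ‖E x p t ω‖ = 1 := fun x p t ω => by
    simp only [E, norm_prod]
    exact Finset.prod_eq_one fun k _ => by rw [mul_comm, Complex.norm_exp_ofReal_mul_I]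
  have hEm : ∀ {x : ℝ → Ω → ℝ} (_ : Measurable (Function.uncurry x)) (p : Fin n → ℝ),
      Measurable fun z : (Fin n → ℝ) × Ω => E x p z.1 z.2 := fun {x} hx p => by
    refine Finset.measurable_prod _ fun k _ => ?_
    have : Measurable fun z : (Fin n → ℝ) × Ω => x (z.1 k) z.2 :=
      hx.comp (f := fun z : (Fin n → ℝ) × Ω => (z.1 k, z.2)) (by fun_prop)
    fun_prop
  have h1 : ∀ ω, ∏ k, (occupationFourier x (p k) ω * occupationFourier y (-p k) ω) =
      ∫ z, E x p z.1 ω * E y (-p) z.2 ω ∂(μ.prod μ) := fun ω => by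
    rw [Finset.prod_mul_distrib, prod_occupationFourier, prod_occupationFourier,
      integral_prod_mul (E x p · ω) (E y (-p) · ω)]
    rfl
  have hint : Integrable (Function.uncurry fun (ω : Ω) (z : (Fin n → ℝ) × (Fin n → ℝ)) =>
      E x p z.1 ω * E y (-p) z.2 ω) (P.prod (μ.prod μ)) := by
    refine (integrable_const (1 : ℝ)).mono' ?_ (ae_of_all _ fun z => ?_)
    · exact (((hEm hx p).comp ((measurable_fst.comp measurable_snd).prodMk measurable_fst)).mul
        ((hEm hy (-p)).comp ((measurable_snd.comp measurable_snd).prodMk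
          measurable_fst))).aestronglyMeasurable
    · simp [Function.uncurry, hEn]
  have h2 : ∫ ω, ∏ k, (occupationFourier x (p k) ω * occupationFourier y (-p k) ω) ∂P =
      (∫ t, (Real.exp (-(a * brownianQuad p t)) : ℂ) ∂μ) *
        ∫ s, (Real.exp (-(b * brownianQuad p s)) : ℂ) ∂μ := by
    simp_rw [h1]
    rw [integral_integral_swap hint, ← integral_prod_mul]
    refine integral_congr_ae ?_
    have hnn := ae_pi_restrict_Ioc_nonneg n
    filter_upwards [Measure.quasiMeasurePreserving_fst.ae hnn,
      Measure.quasiMeasurePreserving_snd.ae hnn] with z hz1 hz2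
    exact hchar n p z.1 z.2 hz1 hz2
  rw [h2, enorm_mul]
  gcongr
  · exact enorm_integral_cube_le a p
  · exact enorm_integral_cube_le b p

theorem enorm_integral_intersectionFunctional_pow_le (hx : Measurable (Function.uncurry x))
    (hy : Measurable (Function.uncurry y)) {a b : ℝ} (hchar : HasBrownianCharFun P x y a b)
    (hφ : Integrable φ) (n : ℕ) :
    ‖∫ ω, intersectionFunctional x y φ ω ^ n ∂P‖ₑ ≤
      ∫⁻ p : Fin n → ℝ, (∏ k, ‖φ (p k)‖ₑ) * (cubeIntegral a p * cubeIntegral b p) := by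
  have h1 : ∀ ω, intersectionFunctional x y φ ω ^ n = ∫ p : Fin n → ℝ,
      (∏ k, φ (p k)) * ∏ k, (occupationFourier x (p k) ω * occupationFourier y (-p k) ω) := by
    intro ω
    have := integral_fintype_prod_volume_eq_pow (ι := Fin n) fun p =>
      φ p * (occupationFourier x p ω * occupationFourier y (-p) ω)
    rw [Fintype.card_fin] at this
    rw [intersectionFunctional, ← this]
    simp_rw [Finset.prod_mul_distrib]
  have hm : ∀ {x : ℝ → Ω → ℝ} (_ : Measurable (Function.uncurry x)) (c : ℝ) (k : Fin n),
      Measurable fun z : Ω × (Fin n → ℝ) => occupationFourier x (c * z.2 k) z.1 :=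
    fun {x} hx c k => (stronglyMeasurable_occupationFourier hx).measurable.comp
      (f := fun z : Ω × (Fin n → ℝ) => (c * z.2 k, z.1)) (by fun_prop)
  have hint : Integrable (Function.uncurry fun (ω : Ω) (p : Fin n → ℝ) =>
      (∏ k, φ (p k)) * ∏ k, (occupationFourier x (p k) ω * occupationFourier y (-p k) ω))
      (P.prod volume) := by
    have hI : Integrable fun p : Fin n → ℝ => ∏ k, φ (p k) := Integrable.fintype_prod fun _ => hφ
    refine (hI.comp_snd P).mul_bdd (c := 1) ?_ (ae_of_all _ fun z => ?_)
    · refine (Finset.measurable_prod _ fun k _ => ?_).aestronglyMeasurable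
      simpa [Pi.mul_def] using (hm hx 1 k).mul (hm hy (-1) k)
    · rw [norm_prod]
      refine Finset.prod_le_one (fun _ _ => norm_nonneg _) fun k _ => ?_
      rw [norm_mul]
      exact mul_le_one₀ (norm_occupationFourier_le x _ _) (norm_nonneg _)
        (norm_occupationFourier_le y _ _)
  simp_rw [h1]
  rw [integral_integral_swap hint]
  refine (enorm_integral_le_lintegral_enorm _).trans (lintegral_mono fun p => ?_)
  rw [integral_const_mul, enorm_mul]
  gcongr
  · rw [← ofReal_norm, norm_prod, ENNReal.ofReal_prod_of_nonneg fun _ _ => norm_nonneg _]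
    simp_rw [ofReal_norm]
    exact le_rfl
  · exact enorm_integral_prod_occupationFourier_le hx hy hchar p

/-- The functional is real and n is even, so |Z|^n = Z^n; the absolute moment is thus one that can
be expanded in momenta. -/
theorem lintegral_enorm_intersectionFunctional_pow_le (hx : Measurable (Function.uncurry x))
    (hy : Measurable (Function.uncurry y)) {a b : ℝ} (hchar : HasBrownianCharFun P x y a b)
    (hφm : Measurable φ) (hφ : Integrable φ) (hconj : ∀ p, (starRingEnd ℂ) (φ p) = φ (-p))
    {n : ℕ} (hn : Even n) :
    ∫⁻ ω, ‖intersectionFunctional x y φ ω‖ₑ ^ n ∂P ≤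
      ∫⁻ p : Fin n → ℝ, (∏ k, ‖φ (p k)‖ₑ) * (cubeIntegral a p * cubeIntegral b p) := by
  refine le_trans (le_of_eq ?_)
    (enorm_integral_intersectionFunctional_pow_le hx hy hchar hφ n)
  set Z := intersectionFunctional x y φ with hZ
  have hre : ∀ ω, ((Z ω).re : ℂ) = Z ω := fun ω =>
    Complex.conj_eq_iff_re.1 (conj_intersectionFunctional x y hconj ω)
  have hZm : StronglyMeasurable Z := stronglyMeasurable_intersectionFunctional hx hy hφm
  have h1 : ∀ ω, ‖Z ω‖ₑ ^ n = ENNReal.ofReal ((Z ω).re ^ n) := fun ω => by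
    rw [← ofReal_norm, ← ENNReal.ofReal_pow (norm_nonneg _), ← hre ω, Complex.norm_real,
      Real.norm_eq_abs, hn.pow_abs, Complex.ofReal_re]
  have h2 : ∀ ω, Z ω ^ n = (((Z ω).re ^ n : ℝ) : ℂ) := fun ω => by
    rw [Complex.ofReal_pow, hre]
  have hint : Integrable (fun ω => (Z ω).re ^ n) P := by
    refine (integrable_const ((∫ p, ‖φ p‖) ^ n)).mono' ?_ (ae_of_all _ fun ω => ?_)
    · exact ((Complex.measurable_re.comp hZm.measurable).pow_const n).aestronglyMeasurable
    · rw [norm_pow]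
      gcongr
      exact (Complex.abs_re_le_norm _).trans (norm_intersectionFunctional_le x y hφ ω)
  simp_rw [h1, h2]
  rw [← ofReal_integral_eq_lintegral_ofReal hint (ae_of_all _ fun ω => hn.pow_nonneg _),
    integral_complex_ofReal, ← ofReal_norm, Complex.norm_real,
    Real.norm_of_nonneg (integral_nonneg fun ω => hn.pow_nonneg _)]

end Functional

end Occupation

/-! ### Limits in all even exponents and exponential moments -/

theorem eLpNorm_natCast_eq {Ω E : Type*} [MeasurableSpace Ω] [NormedAddCommGroup E]
    (P : Measure Ω) (f : Ω → E) {n : ℕ} (hn : n ≠ 0) :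
    eLpNorm f n P = (∫⁻ ω, ‖f ω‖ₑ ^ n ∂P) ^ (1 / (n : ℝ)) := by
  rw [eLpNorm_eq_lintegral_rpow_enorm_toReal (by exact_mod_cast hn) (ENNReal.natCast_ne_top n)]
  simp

/-- Completeness of L² along ε = 1/(k+1) yields one candidate, also an almost sure limit along a
subsequence. Fatou's lemma then gives convergence to this same candidate in every even exponent, and
along the whole filter. -/
theorem exists_tendsto_eLpNorm_of_cauchy {Ω : Type*} [MeasurableSpace Ω] {P : Measure Ω}
    {Z : ℝ → Ω → ℂ} (hL2 : ∀ ε, 0 < ε → MemLp (Z ε) 2 P)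
    (hc : ∀ n : ℕ, Even n → n ≠ 0 →
      Tendsto (fun q : ℝ × ℝ => eLpNorm (Z q.1 - Z q.2) n P) (𝓝[>] 0 ×ˢ 𝓝[>] 0) (𝓝 0)) :
    ∃ θ : Ω → ℂ, AEStronglyMeasurable θ P ∧ ∀ n : ℕ, Even n → n ≠ 0 →
      Tendsto (fun ε => eLpNorm (Z ε - θ) n P) (𝓝[>] 0) (𝓝 0) := by
  let e : ℕ → ℝ := fun k => 1 / ((k : ℝ) + 1)
  have he0 : ∀ k, 0 < e k := fun k => by positivity
  have he : Tendsto e atTop (𝓝[>] 0) :=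
    tendsto_nhdsWithin_iff.2 ⟨tendsto_one_div_add_atTop_nhds_zero_nat, Eventually.of_forall he0⟩
  let g : ℕ → Lp ℂ 2 P := fun k => (hL2 (e k) (he0 k)).toLp (Z (e k))
  have hg : CauchySeq g := by
    rw [Lp.cauchySeq_Lp_iff_cauchySeq_eLpNorm, ← prod_atTop_atTop_eq]
    refine ((hc 2 even_two two_ne_zero).comp (he.prodMap he)).congr fun q => ?_
    exact eLpNorm_congr_ae ((MemLp.coeFn_toLp _).symm.sub (MemLp.coeFn_toLp _).symm)
  obtain ⟨f, hf⟩ := cauchySeq_tendsto_of_complete hg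
  rw [Lp.tendsto_Lp_iff_tendsto_eLpNorm'] at hf
  have hmeas := tendstoInMeasure_of_tendsto_eLpNorm (by norm_num)
    (fun k => (Lp.memLp (g k)).aestronglyMeasurable) (Lp.memLp f).aestronglyMeasurable hf
  obtain ⟨ns, hns, hae⟩ := hmeas.exists_seq_tendsto_ae
  have hae' : ∀ᵐ ω ∂P, Tendsto (fun i => Z (e (ns i)) ω) atTop (𝓝 (f ω)) := by
    have : ∀ᵐ ω ∂P, ∀ k, g k ω = Z (e k) ω := ae_all_iff.2 fun k => MemLp.coeFn_toLp _
    filter_upwards [hae, this] with ω h1 h2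
    simpa only [h2] using h1
  refine ⟨f, (Lp.memLp f).aestronglyMeasurable, fun n hn hn0 => ?_⟩
  rw [ENNReal.tendsto_nhds_zero]
  intro η hη
  have hev := ENNReal.tendsto_nhds_zero.1 (hc n hn hn0) η hη
  obtain ⟨s, hs, hs'⟩ := Filter.eventually_prod_self_iff'.1 hev
  filter_upwards [hs, self_mem_nhdsWithin] with ε hε hε0
  have hsub : Tendsto (fun i => e (ns i)) atTop (𝓝[>] 0) := he.comp hns.tendsto_atTop
  refine Lp.eLpNorm_le_of_ae_tendsto (u := atTop) (f := fun i => Z ε - Z (e (ns i))) ?_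
    (fun i => (hL2 ε hε0).aestronglyMeasurable.sub (hL2 _ (he0 _)).aestronglyMeasurable) ?_
  · filter_upwards [hsub.eventually_mem hs] with i hi
    exact hs' ε hε _ hi
  · filter_upwards [hae'] with ω h
    exact tendsto_const_nhds.sub h

theorem ENNReal.ofReal_exp_abs_le_tsum (x : ℝ) :
    ENNReal.ofReal (Real.exp |x|) ≤
      2 * ∑' m : ℕ, ENNReal.ofReal (x ^ (2 * m) / (2 * m).factorial) := by
  have hs := Real.hasSum_cosh x
  have h0 : ∀ m : ℕ, 0 ≤ x ^ (2 * m) / (2 * m).factorial := fun m => by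
    have := (even_two_mul m).pow_nonneg x
    positivity
  rw [← ENNReal.ofReal_tsum_of_nonneg h0 hs.summable, hs.tsum_eq, ← ENNReal.ofReal_ofNat,
    ← ENNReal.ofReal_mul (by norm_num)]
  refine ENNReal.ofReal_le_ofReal ?_
  rw [← Real.cosh_abs, Real.cosh_eq]
  have := Real.exp_pos (-|x|)
  linarith

/-- As exp|x| ≤ 2 cosh x, only even moments enter. At the rate 1/(2C) the term of order 2m is at
most A · 4⁻ᵐ. -/
theorem integrable_exp_mul_abs_of_even_moments {Ω : Type*} [MeasurableSpace Ω] {P : Measure Ω}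
    [IsProbabilityMeasure P] {θ : Ω → ℝ} (hθ : AEMeasurable θ P) {A C : ℝ} (hA : 1 ≤ A)
    (hC : 0 < C) (h : ∀ n : ℕ, Even n → n ≠ 0 →
      ∫⁻ ω, ‖θ ω‖ₑ ^ n ∂P ≤ ENNReal.ofReal (A * n.factorial * C ^ n)) :
    Integrable (fun ω => Real.exp (1 / (2 * C) * |θ ω|)) P := by
  have hm : AEMeasurable (fun ω => Real.exp (1 / (2 * C) * |θ ω|)) P := by fun_prop
  refine ⟨hm.aestronglyMeasurable, ?_⟩
  rw [hasFiniteIntegral_iff_ofReal (ae_of_all _ fun _ => (Real.exp_pos _).le)]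
  have hterm : ∀ m : ℕ,
      ∫⁻ ω, ENNReal.ofReal ((1 / (2 * C) * θ ω) ^ (2 * m) / (2 * m).factorial) ∂P ≤
      ENNReal.ofReal (A * (1 / 4) ^ m) := by
    intro m
    have he : ∀ ω, ENNReal.ofReal ((1 / (2 * C) * θ ω) ^ (2 * m) / (2 * m).factorial) =
        ENNReal.ofReal ((1 / (2 * C)) ^ (2 * m) / (2 * m).factorial) * ‖θ ω‖ₑ ^ (2 * m) := by
      intro ω
      rw [← ofReal_norm, ← ENNReal.ofReal_pow (norm_nonneg _), Real.norm_eq_abs,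
        (even_two_mul m).pow_abs, ← ENNReal.ofReal_mul (by positivity)]
      congr 1
      ring
    simp_rw [he]
    rw [lintegral_const_mul'' _ (by fun_prop)]
    have hmom : ∫⁻ ω, ‖θ ω‖ₑ ^ (2 * m) ∂P ≤
        ENNReal.ofReal (A * (2 * m).factorial * C ^ (2 * m)) := by
      -- The zeroth moment is 1 for a probability measure; this is the use of 1 ≤ A.
      rcases eq_or_ne m 0 with rfl | hm0
      · simpa using hA
      · exact h _ (even_two_mul m) (by omega)
    refine (mul_le_mul_right hmom _).trans_eq ?_
    rw [← ENNReal.ofReal_mul (by positivity)]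
    congr 1
    have h4 : (1 / 4 : ℝ) ^ m = (1 / (2 * C)) ^ (2 * m) * C ^ (2 * m) := by
      rw [← mul_pow, pow_mul]
      congr 1
      field_simp
      norm_num
    rw [h4]
    field_simp
  have hgeo : Summable fun m : ℕ => A * (1 / 4 : ℝ) ^ m :=
    (summable_geometric_of_lt_one (by norm_num) (by norm_num)).mul_left A
  calc ∫⁻ ω, ENNReal.ofReal (Real.exp (1 / (2 * C) * |θ ω|)) ∂P
      ≤ ∫⁻ ω, 2 * ∑' m : ℕ,
          ENNReal.ofReal ((1 / (2 * C) * θ ω) ^ (2 * m) / (2 * m).factorial) ∂P := by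
        refine lintegral_mono fun ω => ?_
        have : 1 / (2 * C) * |θ ω| = |1 / (2 * C) * θ ω| := by
          rw [abs_mul, abs_of_pos (by positivity : 0 < 1 / (2 * C))]
        simp only [this]
        exact ENNReal.ofReal_exp_abs_le_tsum _
    _ = 2 * ∑' m : ℕ, ∫⁻ ω,
          ENNReal.ofReal ((1 / (2 * C) * θ ω) ^ (2 * m) / (2 * m).factorial) ∂P := by
        rw [lintegral_const_mul' _ _ (by norm_num), lintegral_tsum fun m => by fun_prop]
    _ ≤ 2 * ∑' m : ℕ, ENNReal.ofReal (A * (1 / 4) ^ m) := by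
        gcongr with m
        exact hterm m
    _ < ∞ := by
        rw [← ENNReal.ofReal_tsum_of_nonneg (fun m => by positivity) hgeo]
        exact ENNReal.mul_lt_top (by norm_num) ENNReal.ofReal_lt_top

theorem integrable_exp_mul_abs_rpow {Ω : Type*} [MeasurableSpace Ω] {P : Measure Ω}
    {θ : Ω → ℝ} (hθ : AEMeasurable θ P) {M β : ℝ} (hM : 0 ≤ M) (hβ0 : 0 ≤ β) (hβ1 : β ≤ 1)
    (h : Integrable (fun ω => Real.exp (M * |θ ω|)) P) :
    Integrable (fun ω => Real.exp (M * |θ ω| ^ β)) P := by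
  refine (h.const_mul (Real.exp M)).mono' ?_ (ae_of_all _ fun ω => ?_)
  · have : AEMeasurable (fun ω => Real.exp (M * |θ ω| ^ β)) P := by fun_prop
    exact this.aestronglyMeasurable
  · rw [Real.norm_of_nonneg (Real.exp_pos _).le, ← Real.exp_add, Real.exp_le_exp]
    have : |θ ω| ^ β ≤ 1 + |θ ω| := by
      calc |θ ω| ^ β ≤ (1 + |θ ω|) ^ β := by
            gcongr
            linarith
        _ ≤ (1 + |θ ω|) ^ (1 : ℝ) :=
            Real.rpow_le_rpow_of_exponent_le (by linarith [abs_nonneg (θ ω)]) hβ1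
        _ = _ := Real.rpow_one _
    nlinarith [mul_le_mul_of_nonneg_left this hM]

/-! ### The heat kernel multiplier -/

/-- The multiplier in frequency space of the derivative of the heat kernel of variance `ε`. -/
noncomputable def diltKernel (ε p : ℝ) : ℂ :=
  Complex.I / (2 * (Real.pi : ℂ)) * ((p * Real.exp (-(ε * p ^ 2 / 2)) : ℝ) : ℂ)

theorem measurable_diltKernel (ε : ℝ) : Measurable (diltKernel ε) := by
  unfold diltKernel
  fun_prop

theorem integrable_diltKernel {ε : ℝ} (hε : 0 < ε) : Integrable (diltKernel ε) := by
  have h := (integrable_mul_exp_neg_mul_sq (half_pos hε)).ofReal (𝕜 := ℂ)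
  refine (h.const_mul (Complex.I / (2 * (Real.pi : ℂ)))).congr (ae_of_all _ fun p => ?_)
  simp only [diltKernel]
  congr 4
  ring

theorem conj_diltKernel (ε p : ℝ) : (starRingEnd ℂ) (diltKernel ε p) = diltKernel ε (-p) := by
  simp only [diltKernel, map_mul, map_div₀, Complex.conj_I, Complex.conj_ofReal, map_ofNat, neg_sq]
  push_cast
  ring

theorem norm_diltKernel_sub (ε δ p : ℝ) :
    ‖diltKernel ε p - diltKernel δ p‖ =
      (2 * Real.pi)⁻¹ * (|p| * |Real.exp (-(ε * p ^ 2 / 2)) - Real.exp (-(δ * p ^ 2 / 2))|) := by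
  rw [diltKernel, diltKernel, ← mul_sub, ← Complex.ofReal_sub, ← mul_sub, norm_mul, norm_div,
    Complex.norm_I, Complex.norm_real, norm_mul, norm_mul, Complex.norm_real, Complex.norm_ofNat,
    Real.norm_of_nonneg Real.pi_pos.le, one_div]
  rfl

theorem norm_diltKernel (ε p : ℝ) :
    ‖diltKernel ε p‖ = (2 * Real.pi)⁻¹ * (|p| * Real.exp (-(ε * p ^ 2 / 2))) := by
  rw [diltKernel, norm_mul, norm_div,
    Complex.norm_I, Complex.norm_real, norm_mul, norm_mul, Complex.norm_real, Complex.norm_ofNat,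
    Real.norm_of_nonneg Real.pi_pos.le, one_div, Real.norm_of_nonneg (Real.exp_pos _).le]
  rfl

theorem inv_two_pi_le_one : (2 * Real.pi)⁻¹ ≤ 1 :=
  inv_le_one_of_one_le₀ (by linarith [Real.pi_gt_three])

theorem exp_neg_mul_sq_le_one {ε : ℝ} (hε : 0 ≤ ε) (p : ℝ) :
    Real.exp (-(ε * p ^ 2 / 2)) ≤ 1 :=
  Real.exp_le_one_iff.2 (neg_nonpos.2 (by positivity))

theorem enorm_diltKernel_le {ε : ℝ} (hε : 0 ≤ ε) (p : ℝ) : ‖diltKernel ε p‖ₑ ≤ ‖p‖ₑ := by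
  rw [enorm_le_iff_norm_le, norm_diltKernel, Real.norm_eq_abs]
  exact (mul_le_of_le_one_left (by positivity) inv_two_pi_le_one).trans
    (mul_le_of_le_one_right (abs_nonneg _) (exp_neg_mul_sq_le_one hε p))

/-- Both Gaussian factors lie in [0, 1], so their difference does too in absolute value. This is the
ε-independent majorant for dominated convergence. -/
theorem enorm_diltKernel_sub_le {ε δ : ℝ} (hε : 0 ≤ ε) (hδ : 0 ≤ δ) (p : ℝ) :
    ‖diltKernel ε p - diltKernel δ p‖ₑ ≤ ‖p‖ₑ := by
  rw [enorm_le_iff_norm_le, norm_diltKernel_sub, Real.norm_eq_abs]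
  refine (mul_le_of_le_one_left (by positivity) inv_two_pi_le_one).trans
    (mul_le_of_le_one_right (abs_nonneg _) ?_)
  have h1 := exp_neg_mul_sq_le_one hε p
  have h2 := exp_neg_mul_sq_le_one hδ p
  have h3 := Real.exp_pos (-(ε * p ^ 2 / 2))
  have h4 := Real.exp_pos (-(δ * p ^ 2 / 2))
  exact abs_le.2 ⟨by linarith, by linarith⟩

theorem tendsto_enorm_diltKernel_sub (p : ℝ) :
    Tendsto (fun q : ℝ × ℝ => ‖diltKernel q.1 p - diltKernel q.2 p‖ₑ)
      (𝓝[>] 0 ×ˢ 𝓝[>] 0) (𝓝 0) := by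
  have hc : Continuous fun q : ℝ × ℝ => ‖diltKernel q.1 p - diltKernel q.2 p‖ₑ := by
    unfold diltKernel
    fun_prop
  have h := hc.tendsto (0, 0)
  simp only [sub_self, enorm_zero, nhds_prod_eq] at h
  exact h.mono_left (Filter.prod_mono nhdsWithin_le_nhds nhdsWithin_le_nhds)

theorem diltApprox_eq_intersectionFunctional {Ω : Type*} [MeasurableSpace Ω] {X Y : ℝ≥0 → Ω → ℝ}
    (hX : Measurable (Function.uncurry fun (t : ℝ) ω => X t.toNNReal ω))
    (hY : Measurable (Function.uncurry fun (t : ℝ) ω => Y t.toNNReal ω))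
    {ε : ℝ} (hε : 0 < ε) (ω : Ω) :
    diltApprox X Y ε ω = intersectionFunctional (fun t ω => X t.toNNReal ω)
      (fun t ω => Y t.toNNReal ω) (diltKernel ε) ω := by
  set μ := (volume : Measure ℝ).restrict (Set.Ioc (0 : ℝ) 1) with hμ
  let x : ℝ → ℝ := fun t => X t.toNNReal ω
  let y : ℝ → ℝ := fun t => Y t.toNNReal ω
  have hx : Measurable x := hX.comp measurable_prodMk_right
  have hy : Measurable y := hY.comp measurable_prodMk_right
  let e : ℝ → ℝ → ℝ → ℂ := fun p t s =>
    Complex.exp (Complex.I * ((p * x t : ℝ) : ℂ)) * Complex.exp (Complex.I * ((-p * y s : ℝ) : ℂ))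
  have hint : Integrable (Function.uncurry fun (z : ℝ × ℝ) (p : ℝ) =>
      diltKernel ε p * e p z.1 z.2) ((μ.prod μ).prod volume) := by
    refine ((integrable_diltKernel hε).comp_snd (μ.prod μ)).mul_bdd (c := 1) ?_
      (ae_of_all _ fun z => ?_)
    · have : Measurable fun z : (ℝ × ℝ) × ℝ => e z.2 z.1.1 z.1.2 := by fun_prop
      exact this.aestronglyMeasurable
    · simp only [e, norm_mul]
      rw [mul_comm Complex.I, mul_comm Complex.I, Complex.norm_exp_ofReal_mul_I,
        Complex.norm_exp_ofReal_mul_I, one_mul]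
  have h1 : diltApprox X Y ε ω = ∫ t, ∫ s, ∫ p, diltKernel ε p * e p t s ∂volume ∂μ ∂μ := by
    rw [diltApprox, intervalIntegral.integral_of_le zero_le_one, ← integral_const_mul]
    refine integral_congr_ae (ae_of_all _ fun t => ?_)
    simp only
    rw [intervalIntegral.integral_of_le zero_le_one, ← integral_const_mul]
    refine integral_congr_ae (ae_of_all _ fun s => ?_)
    simp only
    rw [← integral_const_mul]
    refine integral_congr_ae (ae_of_all _ fun p => ?_)
    simp only [diltKernel, e, x, y]
    rw [← Complex.exp_add, Complex.ofReal_mul p, Complex.ofReal_exp]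
    have : Complex.I * (p : ℂ) * ((X t.toNNReal ω - Y s.toNNReal ω : ℝ) : ℂ) =
        Complex.I * ((p * X t.toNNReal ω : ℝ) : ℂ) +
          Complex.I * ((-p * Y s.toNNReal ω : ℝ) : ℂ) := by
      push_cast
      ring
    rw [this, Complex.ofReal_neg]
    ring
  rw [h1, ← integral_prod (fun z : ℝ × ℝ => ∫ p, diltKernel ε p * e p z.1 z.2)
    hint.integral_prod_left, integral_integral_swap hint, intersectionFunctional]
  refine integral_congr_ae (ae_of_all _ fun p => ?_)
  simp only
  rw [integral_const_mul]
  congr 1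
  exact integral_prod_mul (fun t => Complex.exp (Complex.I * ((p * x t : ℝ) : ℂ)))
    fun s => Complex.exp (Complex.I * ((-p * y s : ℝ) : ℂ))

/-! ### Measurable versions, characteristic functions and passage to the limit -/

/-- Fubini needs joint measurability, whereas the paths are only almost surely continuous with a.e.
measurable coordinates. Setting the process to zero on a measurable null set makes all paths
continuous and the coordinates measurable at a countable dense set of times; limits give all times,
and continuity gives joint measurability. -/
theorem exists_measurable_modification {Ω : Type*} [MeasurableSpace Ω] {P : Measure Ω}
    {B : ℝ≥0 → Ω → ℝ} (hB : IsBrownianReal B P) :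
    ∃ B' : ℝ≥0 → Ω → ℝ, IsPreBrownianReal B' P ∧ Measurable (Function.uncurry B') ∧
      ∀ᵐ ω ∂P, ∀ t, B t ω = B' t ω := by
  obtain ⟨D, hDc, hDd⟩ := TopologicalSpace.exists_countable_dense ℝ≥0
  have hae : ∀ᵐ ω ∂P, Continuous (B · ω) ∧ ∀ q ∈ D, B q ω = (hB.aemeasurable q).mk (B q) ω := by
    filter_upwards [hB.cont, (ae_ball_iff hDc).2 fun q _ => (hB.aemeasurable q).ae_eq_mk]
      with ω h1 h2
    exact ⟨h1, h2⟩
  obtain ⟨N, hN, hNm, hN0⟩ := exists_measurable_superset_of_null (ae_iff.1 hae)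
  have hgood : ∀ ω ∈ Nᶜ, Continuous (B · ω) ∧ ∀ q ∈ D, B q ω = (hB.aemeasurable q).mk (B q) ω :=
    fun ω hω => by_contra fun h => hω (hN h)
  let B' : ℝ≥0 → Ω → ℝ := fun t => Nᶜ.indicator (B t)
  have hcont : ∀ ω, Continuous (B' · ω) := fun ω => by
    by_cases hω : ω ∈ Nᶜ
    · simpa only [B', Set.indicator_of_mem hω] using (hgood ω hω).1
    · simpa only [B', Set.indicator_of_notMem hω] using continuous_const
  have hmD : ∀ q ∈ D, Measurable (B' q) := fun q hq => by
    have : B' q = Nᶜ.indicator ((hB.aemeasurable q).mk (B q)) :=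
      Set.indicator_congr fun ω hω => (hgood ω hω).2 q hq
    rw [this]
    exact (hB.aemeasurable q).measurable_mk.indicator hNm.compl
  have hm : ∀ t, Measurable (B' t) := fun t => by
    obtain ⟨u, huD, hu⟩ := mem_closure_iff_seq_limit.1 (hDd t)
    exact measurable_of_tendsto_metrizable (fun k => hmD (u k) (huD k))
      (tendsto_pi_nhds.2 fun ω => ((hcont ω).tendsto t).comp hu)
  have heq : ∀ᵐ ω ∂P, ∀ t, B t ω = B' t ω := by
    have : ∀ᵐ ω ∂P, ω ∈ Nᶜ := measure_eq_zero_iff_ae_notMem.1 hN0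
    filter_upwards [this] with ω hω t
    exact (Set.indicator_of_mem hω _).symm
  exact ⟨B', hB.toIsPreBrownianReal.congr fun t => heq.mono fun ω h => h t,
    measurable_uncurry_of_continuous_of_measurable hcont hm, heq⟩

theorem hasBrownianCharFun_of_indepFun {Ω : Type*} [MeasurableSpace Ω] {P : Measure Ω}
    {B₁ B₂ : ℝ≥0 → Ω → ℝ} (hB₁ : IsPreBrownianReal B₁ P) (hB₂ : IsPreBrownianReal B₂ P)
    (hind : IndepFun (fun ω t => B₁ t ω) (fun ω t => B₂ t ω) P) (c₁ c₂ : ℝ) :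
    HasBrownianCharFun P (fun t ω => c₁ * B₁ t.toNNReal ω) (fun t ω => c₂ * B₂ t.toNNReal ω)
      (c₁ ^ 2 / 2) (c₂ ^ 2 / 2) := by
  intro n p t s ht hs
  let F : ℝ → (Fin n → ℝ) → (Fin n → ℝ) → (ℝ≥0 → ℝ) → ℂ := fun c p t f =>
    Complex.exp (Complex.I * ((∑ k, p k * (c * f (t k).toNNReal) : ℝ) : ℂ))
  have hF : ∀ c p t, Measurable (F c p t) := fun c p t => by fun_prop
  have hprod : ∀ c (B : ℝ≥0 → Ω → ℝ) p t ω,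
      ∏ k, Complex.exp (Complex.I * ((p k * (c * B (t k).toNNReal ω) : ℝ) : ℂ)) =
        F c p t fun t => B t ω := fun c B p t ω => by
    rw [← Complex.exp_sum, ← Finset.mul_sum, ← Complex.ofReal_sum]
  have hmeas : ∀ {B : ℝ≥0 → Ω → ℝ} (_ : IsPreBrownianReal B P) c p t,
      AEStronglyMeasurable (fun ω => F c p t fun t => B t ω) P := fun {B} hB c p t => by
    have : ∀ k, AEMeasurable (B (t k).toNNReal) P := fun k => hB.aemeasurable _
    have : AEMeasurable (fun ω => F c p t fun t => B t ω) P := by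
      simp only [F]
      fun_prop
    exact this.aestronglyMeasurable
  have hq : brownianQuad (fun k => -p k) s = brownianQuad p s := by simp [brownianQuad]
  have hindF : IndepFun (fun ω => F c₁ p t fun t => B₁ t ω)
      (fun ω => F c₂ (fun k => -p k) s fun t => B₂ t ω) P := hind.comp (hF _ _ _) (hF _ _ _)
  simp_rw [hprod c₁ B₁ p t, hprod c₂ B₂ (fun k => -p k) s]
  rw [hindF.integral_fun_mul_eq_mul_integral (hmeas hB₁ _ _ _) (hmeas hB₂ _ _ _),
    integral_cexp_sum_brownian hB₁ c₁ p ht, integral_cexp_sum_brownian hB₂ c₂ _ hs, hq]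

theorem lintegral_enorm_pow_le_of_tendsto {Ω : Type*} [MeasurableSpace Ω] {P : Measure Ω}
    {Z : ℝ → Ω → ℂ} {θ : Ω → ℝ} (hθ : AEMeasurable θ P)
    (hZm : ∀ ε, AEStronglyMeasurable (Z ε) P) {n : ℕ} (hn : n ≠ 0) {K : ℝ≥0∞}
    (hK : ∀ ε, 0 < ε → ∫⁻ ω, ‖Z ε ω‖ₑ ^ n ∂P ≤ K)
    (hlim : Tendsto (fun ε => eLpNorm (fun ω => Z ε ω - (θ ω : ℂ)) n P) (𝓝[>] 0) (𝓝 0)) :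
    ∫⁻ ω, ‖θ ω‖ₑ ^ n ∂P ≤ K := by
  have hn' : (0 : ℝ) < n := by positivity
  have hθc : AEStronglyMeasurable (fun ω => (θ ω : ℂ)) P :=
    (Complex.measurable_ofReal.comp_aemeasurable hθ).aestronglyMeasurable
  have hnorm : eLpNorm (fun ω => (θ ω : ℂ)) n P ≤ K ^ (1 / (n : ℝ)) := by
    have hlim' := (tendsto_const_nhds (x := K ^ (1 / (n : ℝ)))).add hlim
    rw [add_zero] at hlim'
    refine ge_of_tendsto hlim' ?_
    filter_upwards [self_mem_nhdsWithin] with ε hε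
    calc eLpNorm (fun ω => (θ ω : ℂ)) n P
        = eLpNorm (Z ε - (fun ω => Z ε ω - (θ ω : ℂ))) n P := by
          congr 1
          ext ω
          simp
      _ ≤ eLpNorm (Z ε) n P + eLpNorm (fun ω => Z ε ω - (θ ω : ℂ)) n P :=
          eLpNorm_sub_le (hZm ε) ((hZm ε).sub hθc) (by exact_mod_cast Nat.one_le_iff_ne_zero.2 hn)
      _ ≤ _ := by
          gcongr
          rw [eLpNorm_natCast_eq P _ hn]
          gcongr
          exact hK ε hε
  rw [eLpNorm_natCast_eq P _ hn, ENNReal.rpow_le_rpow_iff (by positivity)] at hnorm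
  refine le_trans (le_of_eq (lintegral_congr fun ω => ?_)) hnorm
  rw [← ofReal_norm, ← ofReal_norm, Complex.norm_real]

/-! ### Convergence and uniform moment bounds -/

section Brownian

variable {Ω : Type*} [MeasurableSpace Ω] {P : Measure Ω} [IsProbabilityMeasure P]
  {x y : ℝ → Ω → ℝ} {a b : ℝ}

/-- The difference is the functional of the difference of kernels, which is Hermitian, tends to 0
pointwise and is dominated by |p|; the momentum bound is the integrable majorant. -/
theorem tendsto_lintegral_enorm_intersectionFunctional_sub_pow
    (hx : Measurable (Function.uncurry x)) (hy : Measurable (Function.uncurry y))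
    (hchar : HasBrownianCharFun P x y a b) (ha : 0 < a) (hb : 0 < b) {n : ℕ} (hn : Even n)
    (hn0 : n ≠ 0) :
    Tendsto (fun q : ℝ × ℝ => ∫⁻ ω, ‖intersectionFunctional x y (diltKernel q.1) ω -
      intersectionFunctional x y (diltKernel q.2) ω‖ₑ ^ n ∂P) (𝓝[>] 0 ×ˢ 𝓝[>] 0) (𝓝 0) := by
  obtain ⟨C, -, hC⟩ := exists_lintegral_prod_mul_cubeIntegral_le ha hb
  have hpos : ∀ᶠ q : ℝ × ℝ in 𝓝[>] 0 ×ˢ 𝓝[>] 0, 0 < q.1 ∧ 0 < q.2 :=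
    (eventually_mem_nhdsWithin (s := Set.Ioi (0 : ℝ))).prod_mk eventually_mem_nhdsWithin
  have hFm : Measurable fun p : Fin n → ℝ => cubeIntegral a p * cubeIntegral b p :=
    (measurable_cubeIntegral a n).mul (measurable_cubeIntegral b n)
  have hfin := (hC n hn0).trans_lt ENNReal.ofReal_lt_top
  have hlim : Tendsto (fun q : ℝ × ℝ => ∫⁻ p : Fin n → ℝ,
      (∏ k, ‖diltKernel q.1 (p k) - diltKernel q.2 (p k)‖ₑ) *
        (cubeIntegral a p * cubeIntegral b p)) (𝓝[>] 0 ×ˢ 𝓝[>] 0) (𝓝 0) := by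
    rw [← lintegral_zero (μ := (volume : Measure (Fin n → ℝ)))]
    refine tendsto_lintegral_filter_of_dominated_convergence
      (fun p : Fin n → ℝ => (∏ k, ‖p k‖ₑ) * (cubeIntegral a p * cubeIntegral b p)) ?_ ?_ hfin.ne ?_
    · refine Eventually.of_forall fun q => Measurable.mul ?_ hFm
      have h1 := measurable_diltKernel q.1
      have h2 := measurable_diltKernel q.2
      fun_prop
    · filter_upwards [hpos] with q hq
      refine ae_of_all _ fun p => ?_
      gcongr
      exact enorm_diltKernel_sub_le hq.1.le hq.2.le _
    · have hD : Measurable fun p : Fin n → ℝ =>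
          (∏ k, ‖p k‖ₑ) * (cubeIntegral a p * cubeIntegral b p) := by fun_prop
      filter_upwards [ae_lt_top hD hfin.ne] with p hp
      have hprod : Tendsto (fun q : ℝ × ℝ => ∏ k, ‖diltKernel q.1 (p k) - diltKernel q.2 (p k)‖ₑ)
          (𝓝[>] 0 ×ˢ 𝓝[>] 0) (𝓝 0) := by
        have h := ENNReal.tendsto_finsetProd_of_ne_top Finset.univ
          (fun k _ => tendsto_enorm_diltKernel_sub (p k)) fun _ _ => ENNReal.zero_ne_top
        simpa [hn0] using h
      -- Where the time integrals are infinite, finiteness of the majorant forces ∏|p_k| = 0, and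
      -- the integrand vanishes for all positive parameters; otherwise the limit can be taken in the
      -- product.
      by_cases hF : cubeIntegral a p * cubeIntegral b p = ∞
      · have h0 : ∏ k, ‖p k‖ₑ = 0 := by
          by_contra h0
          rw [hF, ENNReal.mul_top h0] at hp
          exact lt_irrefl _ hp
        refine tendsto_const_nhds.congr' ?_
        filter_upwards [hpos] with q hq
        have h1 : ∏ k, ‖diltKernel q.1 (p k) - diltKernel q.2 (p k)‖ₑ ≤ ∏ k, ‖p k‖ₑ :=
          Finset.prod_le_prod' fun k _ => enorm_diltKernel_sub_le hq.1.le hq.2.le _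
        rw [le_zero_iff.1 (h1.trans_eq h0), zero_mul]
      · simpa using ENNReal.Tendsto.mul_const hprod (Or.inr hF)
  refine tendsto_of_tendsto_of_tendsto_of_le_of_le' tendsto_const_nhds hlim
    (Eventually.of_forall fun _ => zero_le) ?_
  filter_upwards [hpos] with q hq
  have hi1 := integrable_diltKernel hq.1
  have hi2 := integrable_diltKernel hq.2
  simp_rw [← intersectionFunctional_sub hx hy hi1 hi2]
  exact lintegral_enorm_intersectionFunctional_pow_le hx hy hchar
    ((measurable_diltKernel _).sub (measurable_diltKernel _)) (hi1.sub hi2)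
    (fun p => by simp only [Pi.sub_apply, map_sub, conj_diltKernel]) hn

theorem exists_lintegral_enorm_intersectionFunctional_pow_le
    (hx : Measurable (Function.uncurry x)) (hy : Measurable (Function.uncurry y))
    (hchar : HasBrownianCharFun P x y a b) (ha : 0 < a) (hb : 0 < b) :
    ∃ C : ℝ, 0 < C ∧ ∀ n : ℕ, Even n → n ≠ 0 → ∀ ε, 0 < ε →
      ∫⁻ ω, ‖intersectionFunctional x y (diltKernel ε) ω‖ₑ ^ n ∂P ≤
        ENNReal.ofReal (4 * n.factorial * C ^ n) := by
  obtain ⟨C, hC0, hC⟩ := exists_lintegral_prod_mul_cubeIntegral_le ha hb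
  refine ⟨C, hC0, fun n hn hn0 ε hε => ?_⟩
  refine (lintegral_enorm_intersectionFunctional_pow_le hx hy hchar (measurable_diltKernel ε)
    (integrable_diltKernel hε) (conj_diltKernel ε) hn).trans (le_trans ?_ (hC n hn0))
  gcongr
  exact enorm_diltKernel_le hε.le _

theorem exists_tendsto_intersectionFunctional
    (hx : Measurable (Function.uncurry x)) (hy : Measurable (Function.uncurry y))
    (hchar : HasBrownianCharFun P x y a b) (ha : 0 < a) (hb : 0 < b) :
    ∃ θ : Ω → ℝ, AEMeasurable θ P ∧ ∀ r : ℝ≥0,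
      Tendsto (fun ε => eLpNorm
        (fun ω => intersectionFunctional x y (diltKernel ε) ω - (θ ω : ℂ)) r P) (𝓝[>] 0) (𝓝 0) := by
  have hZm : ∀ ε, AEStronglyMeasurable (intersectionFunctional x y (diltKernel ε)) P := fun ε =>
    (stronglyMeasurable_intersectionFunctional hx hy (measurable_diltKernel ε)).aestronglyMeasurable
  obtain ⟨θ, hθm, hθ⟩ := exists_tendsto_eLpNorm_of_cauchy (P := P)
    (Z := fun ε => intersectionFunctional x y (diltKernel ε))
    (fun ε hε => MemLp.of_bound (hZm ε) _ (ae_of_all _ fun ω =>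
      norm_intersectionFunctional_le x y (integrable_diltKernel hε) ω))
    (fun n hn hn0 => by
      have h := tendsto_lintegral_enorm_intersectionFunctional_sub_pow hx hy hchar ha hb hn hn0
      have hpow := ((ENNReal.continuous_rpow_const (y := 1 / (n : ℝ))).tendsto 0).comp h
      rw [ENNReal.zero_rpow_of_pos (by positivity)] at hpow
      simpa only [eLpNorm_natCast_eq P _ hn0, Pi.sub_apply, Function.comp_def] using hpow)
  refine ⟨fun ω => (θ ω).re, Complex.measurable_re.comp_aemeasurable hθm.aemeasurable,
    fun r => ?_⟩
  obtain ⟨m, hm⟩ := exists_nat_ge r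
  -- A nonzero even exponent that is at least r; on a probability space its norm dominates the L^r
  -- norm.
  set n := 2 * (m + 1) with hn
  refine tendsto_of_tendsto_of_tendsto_of_le_of_le tendsto_const_nhds
    (hθ n (even_two_mul _) (by omega)) (fun _ => zero_le) fun ε => ?_
  have hle : (r : ℝ≥0∞) ≤ n := by
    have : r ≤ (n : ℝ≥0) := hm.trans (by exact_mod_cast (by omega : m ≤ n))
    exact_mod_cast this
  calc _ ≤ eLpNorm (intersectionFunctional x y (diltKernel ε) - θ) r P := by
        refine eLpNorm_mono fun ω => ?_
        have hre : ((intersectionFunctional x y (diltKernel ε) ω).re : ℂ) = _ :=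
          Complex.conj_eq_iff_re.1 (conj_intersectionFunctional x y (conj_diltKernel ε) ω)
        rw [← hre, ← Complex.ofReal_sub, ← Complex.sub_re, Complex.norm_real, Real.norm_eq_abs]
        exact Complex.abs_re_le_norm _
    _ ≤ _ := eLpNorm_le_eLpNorm_of_exponent_le hle ((hZm ε).sub hθm)

end Brownian

/-! ### The main theorem -/

theorem corollary2p3 {Ω : Type*} [MeasurableSpace Ω] (P : Measure Ω) [IsProbabilityMeasure P]
    (B₁ B₂ : ℝ≥0 → Ω → ℝ) (hB₁ : IsBrownianReal B₁ P) (hB₂ : IsBrownianReal B₂ P)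
    (hind : IndepFun (fun ω t => B₁ t ω) (fun ω t => B₂ t ω) P)
    (c₁ c₂ : ℝ) (hc₁ : 0 < c₁) (hc₂ : 0 < c₂) :
    (∃ θ : Ω → ℝ, IsDILT (fun t ω => c₁ * B₁ t ω) (fun t ω => c₂ * B₂ t ω) P θ) ∧
    ∀ θ : Ω → ℝ, IsDILT (fun t ω => c₁ * B₁ t ω) (fun t ω => c₂ * B₂ t ω) P θ →
      ∀ β : ℝ, 0 ≤ β → β < 2 / 3 →
        ∃ M : ℝ, 0 < M ∧ Integrable (fun ω => Real.exp (M * |θ ω| ^ β)) P := by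
  obtain ⟨B₁', hB₁', hm₁, he₁⟩ := exists_measurable_modification hB₁
  obtain ⟨B₂', hB₂', hm₂, he₂⟩ := exists_measurable_modification hB₂
  have hind' : IndepFun (fun ω t => B₁' t ω) (fun ω t => B₂' t ω) P :=
    hind.congr (he₁.mono fun ω h => funext h) (he₂.mono fun ω h => funext h)
  set x : ℝ → Ω → ℝ := fun t ω => c₁ * B₁' t.toNNReal ω with hx_def
  set y : ℝ → Ω → ℝ := fun t ω => c₂ * B₂' t.toNNReal ω with hy_def
  have hmeas : ∀ {B : ℝ≥0 → Ω → ℝ} (_ : Measurable (Function.uncurry B)) (c : ℝ),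
      Measurable (Function.uncurry fun (t : ℝ) ω => c * B t.toNNReal ω) := fun {B} hB c =>
    (hB.comp (f := fun z : ℝ × Ω => (z.1.toNNReal, z.2)) (by fun_prop)).const_mul c
  have hx : Measurable (Function.uncurry x) := hmeas hm₁ c₁
  have hy : Measurable (Function.uncurry y) := hmeas hm₂ c₂
  have hchar : HasBrownianCharFun P x y (c₁ ^ 2 / 2) (c₂ ^ 2 / 2) :=
    hasBrownianCharFun_of_indepFun hB₁' hB₂' hind' c₁ c₂
  have ha : 0 < c₁ ^ 2 / 2 := by positivity
  have hb : 0 < c₂ ^ 2 / 2 := by positivity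
  -- The exceptional null set does not depend on time, so the time integrals agree almost surely for
  -- the original and the modified paths.
  have hZ : ∀ ε, 0 < ε → diltApprox (fun t ω => c₁ * B₁ t ω) (fun t ω => c₂ * B₂ t ω) ε =ᵐ[P]
      intersectionFunctional x y (diltKernel ε) := fun ε hε => by
    filter_upwards [he₁, he₂] with ω h1 h2
    rw [hx_def, hy_def, ← diltApprox_eq_intersectionFunctional
      (X := fun t ω => c₁ * B₁' t ω) (Y := fun t ω => c₂ * B₂' t ω) hx hy hε ω]
    simp only [diltApprox, h1, h2]
  have hlim : ∀ (θ : Ω → ℝ) (r : ℝ≥0∞),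
      Tendsto (fun ε => eLpNorm (fun ω => diltApprox (fun t ω => c₁ * B₁ t ω)
        (fun t ω => c₂ * B₂ t ω) ε ω - (θ ω : ℂ)) r P) (𝓝[>] 0) (𝓝 0) ↔
      Tendsto (fun ε => eLpNorm (fun ω => intersectionFunctional x y (diltKernel ε) ω - (θ ω : ℂ))
        r P) (𝓝[>] 0) (𝓝 0) := fun θ r => by
    refine tendsto_congr' ?_
    filter_upwards [self_mem_nhdsWithin] with ε hε
    exact eLpNorm_congr_ae ((hZ ε hε).mono fun ω h => by simp only [h])
  constructor
  · obtain ⟨θ, hθm, hθ⟩ := exists_tendsto_intersectionFunctional hx hy hchar ha hb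
    exact ⟨θ, hθm, fun r _ => (hlim θ r).2 (hθ r)⟩
  · intro θ hθ β hβ0 hβ
    obtain ⟨C, hC0, hC⟩ := exists_lintegral_enorm_intersectionFunctional_pow_le hx hy hchar ha hb
    -- C comes from the moment bound and does not depend on β. Integrability is obtained for
    -- exponent 1 and passes to β through |θ|^β ≤ 1 + |θ|.
    refine ⟨1 / (2 * C), by positivity, integrable_exp_mul_abs_rpow hθ.aemeasurable (by positivity)
      hβ0 (by linarith) (integrable_exp_mul_abs_of_even_moments hθ.aemeasurable (A := 4)
        (by norm_num) hC0 fun n hn hn0 => ?_)⟩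
    refine lintegral_enorm_pow_le_of_tendsto hθ.aemeasurable
      (Z := fun ε => intersectionFunctional x y (diltKernel ε)) (fun ε =>
        (stronglyMeasurable_intersectionFunctional hx hy
          (measurable_diltKernel ε)).aestronglyMeasurable) hn0 (hC n hn hn0) ?_
    have := hθ.tendsto_Lr n (by positivity)
    rw [ENNReal.coe_natCast] at this
    exact (hlim θ n).1 this
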